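/- Let $\mathcal C$ be a small dg category over a field $k$. A right (left) dg $\mathcal C$-module is a contravariant (covariant) dg functor from $\mathcal C$ to complexes of $k$-vector spaces; a bimodule $K\in\mathcal C^{op}\otimes\mathcal C$ is a family of complexes $K(b,c)$, covariant in $b$ and contravariant in $c$; morphisms of dg (bi)modules are closed of degree $0$. Let $\mathrm{Perf}(\mathcal C)$ be the smallest class of right modules that contains the representable and the acyclic ones and is closed under quasi-isomorphisms, mapping cones, shifts, finite direct sums and direct summands. For a right module $G$ let $\mathrm{ads}(G)$ be the smallest class of right modules that contains $G$ and is closed under quasi-isomorphisms, (possibly infinite) direct sums, direct summands and shifts. For a bimodule $K$ and a right module $F$ let $\Phi_K(F)=F\otimes^{\mathbf L}_{\mathcal C}K$ be the convolution: it is represented, up to quasi-isomorphism, by $P\otimes_{\mathcal C}K$ for any h-flat resolution $P\to F$. A bimodule $K$ is *weakly product* if there is $G\in\mathrm{Perf}(\mathcal C)$ such that $\Phi_K(F)\in\mathrm{ads}(G)$ for all $F\in\mathrm{Perf}(\mathcal C)$. For a left module $G_1$ and a right module $G_2$, the product bimodule is $(G_1\boxtimes G_2)(b,c)=G_1(b)\otimes_k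 G_2(c)$. Let $G_1\boxtimes G_2$ and $G_1'\boxtimes G_2'$ be product bimodules, let $\phi_1:G_1\to G_1'$ be a morphism of left modules and $\phi_2:G_2\to G_2'$ a morphism of right modules, and let $G_{12}''=\mathrm{cone}(\phi_1\boxtimes\phi_2)$. Then: 1. if $G_2,G_2'\in\mathrm{Perf}(\mathcal C)$, then $G_{12}''$ is weakly product; 2. for every right module $F$, $\Phi_{G_{12}''}(F)\in\mathrm{ads}\bigl(G_2\oplus\mathrm{cone}(\phi_2)\oplus G_2'\bigr)$. -/

import Mathlib

open scoped TensorProduct DirectSum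
open CategoryTheory

universe u

namespace DG

/-! ## dg categories -/

/-- A small dg category over the field `k` with set of objects `C`: graded Hom spaces with a
differential `d` of degree one, and a unital associative composition (`comp h g f` is `g ∘ f`)
satisfying `d (g ∘ f) = dg ∘ f + (-1)^|g| g ∘ df`. The degrees carry equality proofs, so that no
transport between `n + (m + p)` and `(n + m) + p` is needed. -/
class DGCategory (k : Type u) [Field k] (C : Type u) where
  Hom : C → C → ℤ → Type u
  [addCommGroup : ∀ X Y n, AddCommGroup (Hom X Y n)]
  [module : ∀ X Y n, Module k (Hom X Y n)]
  d : ∀ {X Y : C} {p q : ℤ}, p + 1 = q → (Hom X Y p →ₗ[k] Hom X Y q)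
  one : ∀ X : C, Hom X X 0
  comp : ∀ {X Y Z : C} {p q r : ℤ}, p + q = r →
    (Hom Y Z p →ₗ[k] Hom X Y q →ₗ[k] Hom X Z r)
  d_d : ∀ {X Y : C} {p q r : ℤ} (h : p + 1 = q) (h' : q + 1 = r) (f : Hom X Y p),
    d h' (d h f) = 0
  d_comp : ∀ {X Y Z : C} {p q r p' q' r' : ℤ} (h : p + q = r) (hp : p + 1 = p')
    (hq : q + 1 = q') (hr : r + 1 = r') (h₁ : p' + q = r') (h₂ : p + q' = r')
    (g : Hom Y Z p) (f : Hom X Y q),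
    d hr (comp h g f) = comp h₁ (d hp g) f + (-1 : k) ^ p • comp h₂ g (d hq f)
  one_comp : ∀ {X Y : C} {p : ℤ} (h : 0 + p = p) (f : Hom X Y p), comp h (one Y) f = f
  comp_one : ∀ {X Y : C} {p : ℤ} (h : p + 0 = p) (f : Hom X Y p), comp h f (one X) = f
  assoc : ∀ {W X Y Z : C} {p q r pq qr s : ℤ} (hpq : p + q = pq) (hqr : q + r = qr)
    (h₁ : pq + r = s) (h₂ : p + qr = s) (h : Hom Y Z p) (g : Hom X Y q) (f : Hom W X r),
    comp h₁ (comp hpq h g) f = comp h₂ h (comp hqr g f)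

attribute [reducible, instance] DGCategory.addCommGroup DGCategory.module

/-- The type with the single object of the unit dg category `k`. -/
inductive Pt : Type u
  | pt : Pt

/-- The field `k` concentrated in degree zero: the degree `n` part is `k` if `n = 0` and `0`
otherwise. -/
def unitDeg (k : Type u) [Field k] (n : ℤ) : Submodule k k where
  carrier := {x | n ≠ 0 → x = 0}
  add_mem' := fun ha hb hn => by rw [ha hn, hb hn, add_zero]
  zero_mem' := fun _ => rfl
  smul_mem' := fun c x hx hn => by rw [hx hn, smul_zero]

/-- The unit dg category: one object, with endomorphism algebra `k` in degree zero. -/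
instance unitDGCategory (k : Type u) [Field k] : DGCategory k Pt.{u} where
  Hom _ _ n := unitDeg k n
  d _ := 0
  one _ := ⟨1, fun h => absurd rfl h⟩
  comp {_ _ _ p q r} h := LinearMap.mk₂ k
    (fun a b => ⟨a.1 * b.1, fun hr => by
      by_cases hp : p = 0
      · have hq : q ≠ 0 := by omega
        rw [b.2 hq, mul_zero]
      · rw [a.2 hp, zero_mul]⟩)
    (fun a a' b => Subtype.ext (add_mul a.1 a'.1 b.1))
    (fun c a b => Subtype.ext (smul_mul_assoc c a.1 b.1))
    (fun a b b' => Subtype.ext (mul_add a.1 b.1 b'.1))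
    (fun c a b => Subtype.ext (mul_smul_comm c a.1 b.1))
  d_d _ _ _ := rfl
  d_comp _ _ _ _ _ _ _ _ := Subtype.ext (by simp)
  one_comp _ f := Subtype.ext (one_mul f.1)
  comp_one _ f := Subtype.ext (mul_one f.1)
  assoc _ _ _ _ a b c := Subtype.ext (mul_assoc a.1 b.1 c.1)

/-! ## dg bimodules -/

/-- A dg bimodule over `B` and `C`: complexes `M b c`, covariant in `b : B` (left action) and
contravariant in `c : C` (right action), that is, a dg module over `Bᵒᵖ ⊗ C`. -/
structure Bimodule (k : Type u) [Field k] (B C : Type u) [DGCategory k B] [DGCategory k C] where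
  obj : B → C → ℤ → Type u
  [addCommGroup : ∀ b c n, AddCommGroup (obj b c n)]
  [module : ∀ b c n, Module k (obj b c n)]
  d : ∀ {b : B} {c : C} {p q : ℤ}, p + 1 = q → (obj b c p →ₗ[k] obj b c q)
  lact : ∀ {b b' : B} {c : C} {p q r : ℤ}, p + q = r →
    (DGCategory.Hom k b b' p →ₗ[k] obj b c q →ₗ[k] obj b' c r)
  ract : ∀ {b : B} {c c' : C} {p q r : ℤ}, p + q = r →
    (obj b c p →ₗ[k] DGCategory.Hom k c' c q →ₗ[k] obj b c' r)
  d_d : ∀ {b : B} {c : C} {p q r : ℤ} (h : p + 1 = q) (h' : q + 1 = r) (x : obj b c p),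
    d h' (d h x) = 0
  d_lact : ∀ {b b' : B} {c : C} {p q r p' q' r' : ℤ} (h : p + q = r) (hp : p + 1 = p')
    (hq : q + 1 = q') (hr : r + 1 = r') (h₁ : p' + q = r') (h₂ : p + q' = r')
    (f : DGCategory.Hom k b b' p) (x : obj b c q),
    d hr (lact h f x) = lact h₁ (DGCategory.d hp f) x + (-1 : k) ^ p • lact h₂ f (d hq x)
  d_ract : ∀ {b : B} {c c' : C} {p q r p' q' r' : ℤ} (h : p + q = r) (hp : p + 1 = p')
    (hq : q + 1 = q') (hr : r + 1 = r') (h₁ : p' + q = r') (h₂ : p + q' = r')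
    (x : obj b c p) (f : DGCategory.Hom k c' c q),
    d hr (ract h x f) = ract h₁ (d hp x) f + (-1 : k) ^ p • ract h₂ x (DGCategory.d hq f)
  one_lact : ∀ {b : B} {c : C} {p : ℤ} (h : 0 + p = p) (x : obj b c p),
    lact h (DGCategory.one b) x = x
  ract_one : ∀ {b : B} {c : C} {p : ℤ} (h : p + 0 = p) (x : obj b c p),
    ract h x (DGCategory.one c) = x
  comp_lact : ∀ {b b' b'' : B} {c : C} {p q r pq qr s : ℤ} (hpq : p + q = pq) (hqr : q + r = qr)
    (h₁ : pq + r = s) (h₂ : p + qr = s) (g : DGCategory.Hom k b' b'' p)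
    (f : DGCategory.Hom k b b' q) (x : obj b c r),
    lact h₁ (DGCategory.comp hpq g f) x = lact h₂ g (lact hqr f x)
  ract_comp : ∀ {b : B} {c c' c'' : C} {p q r pq qr s : ℤ} (hpq : p + q = pq) (hqr : q + r = qr)
    (h₁ : pq + r = s) (h₂ : p + qr = s) (x : obj b c p) (g : DGCategory.Hom k c' c q)
    (f : DGCategory.Hom k c'' c' r),
    ract h₁ (ract hpq x g) f = ract h₂ x (DGCategory.comp hqr g f)
  lact_ract : ∀ {b b' : B} {c c' : C} {p q r pq qr s : ℤ} (hpq : p + q = pq) (hqr : q + r = qr)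
    (h₁ : pq + r = s) (h₂ : p + qr = s) (g : DGCategory.Hom k b b' p) (x : obj b c q)
    (f : DGCategory.Hom k c' c r),
    ract h₁ (lact hpq g x) f = lact h₂ g (ract hqr x f)

attribute [instance] Bimodule.addCommGroup Bimodule.module

/-- Right dg modules over `C` (contravariant functors to complexes): bimodules over `k` and `C`. -/
abbrev RightModule (k : Type u) [Field k] (C : Type u) [DGCategory k C] := Bimodule k Pt.{u} C

/-- Left dg modules over `B` (covariant functors to complexes): bimodules over `B` and `k`. -/
abbrev LeftModule (k : Type u) [Field k] (B : Type u) [DGCategory k B] := Bimodule k B Pt.{u}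

section

variable {k : Type u} [Field k] {A B C : Type u} [DGCategory k A] [DGCategory k B] [DGCategory k C]

/-- Morphisms of dg bimodules: closed morphisms of degree zero. -/
@[ext]
structure BimoduleHom (M N : Bimodule k B C) where
  app : ∀ (b : B) (c : C) (p : ℤ), M.obj b c p →ₗ[k] N.obj b c p
  app_d : ∀ {b : B} {c : C} {p q : ℤ} (h : p + 1 = q) (x : M.obj b c p),
    app b c q (M.d h x) = N.d h (app b c p x)
  app_lact : ∀ {b b' : B} {c : C} {p q r : ℤ} (h : p + q = r) (f : DGCategory.Hom k b b' p)
    (x : M.obj b c q), app b' c r (M.lact h f x) = N.lact h f (app b c q x)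
  app_ract : ∀ {b : B} {c c' : C} {p q r : ℤ} (h : p + q = r) (x : M.obj b c p)
    (f : DGCategory.Hom k c' c q), app b c' r (M.ract h x f) = N.ract h (app b c p x) f

instance : Category.{u} (Bimodule k B C) where
  Hom M N := BimoduleHom M N
  id M :=
    { app := fun _ _ _ => LinearMap.id
      app_d := fun _ _ => rfl
      app_lact := fun _ _ _ => rfl
      app_ract := fun _ _ _ => rfl }
  comp φ ψ :=
    { app := fun b c p => ψ.app b c p ∘ₗ φ.app b c p
      app_d := fun h x => by simp [φ.app_d, ψ.app_d]
      app_lact := fun h f x => by simp [φ.app_lact, ψ.app_lact]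
      app_ract := fun h x f => by simp [φ.app_ract, ψ.app_ract] }

/-- The component of a morphism of bimodules in a bidegree, with target degree only
propositionally equal to the source degree. -/
def BimoduleHom.appOf {M N : Bimodule k B C} (φ : BimoduleHom M N) (b : B) (c : C) {p q : ℤ}
    (h : p = q) : M.obj b c p →ₗ[k] N.obj b c q :=
  h ▸ φ.app b c p

@[simp]
theorem BimoduleHom.appOf_rfl {M N : Bimodule k B C} (φ : BimoduleHom M N) (b : B) (c : C)
    (p : ℤ) : φ.appOf b c (rfl : p = p) = φ.app b c p := rfl

/-- A morphism of bimodules is a quasi-isomorphism if it is injective and surjective on the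
cohomology of each complex `M b c`. -/
def IsQuasiIso {M N : Bimodule k B C} (φ : M ⟶ N) : Prop :=
  ∀ (b : B) (c : C) (p q r : ℤ) (hpq : p + 1 = q) (hqr : q + 1 = r),
    (∀ x : M.obj b c q, M.d hqr x = 0 → (∃ w : N.obj b c p, N.d hpq w = φ.app b c q x) →
      ∃ v : M.obj b c p, M.d hpq v = x) ∧
    (∀ y : N.obj b c q, N.d hqr y = 0 →
      ∃ x : M.obj b c q, M.d hqr x = 0 ∧ ∃ w : N.obj b c p, N.d hpq w = φ.app b c q x - y)

/-- Two bimodules are quasi-isomorphic if they are connected by a zigzag of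
quasi-isomorphisms, i.e. isomorphic in the derived category. -/
def QuasiIsomorphic (M N : Bimodule k B C) : Prop :=
  Relation.EqvGen (fun M N : Bimodule k B C => ∃ φ : M ⟶ N, IsQuasiIso φ) M N

/-- A bimodule is acyclic if all its complexes are exact. -/
def IsAcyclic (M : Bimodule k B C) : Prop :=
  ∀ (b : B) (c : C) (p q r : ℤ) (hpq : p + 1 = q) (hqr : q + 1 = r) (x : M.obj b c q),
    M.d hqr x = 0 → ∃ v : M.obj b c p, M.d hpq v = x

/-! ## shifts, cones and direct sums -/

/-- The sign `(-1)^n`, which is its own inverse. -/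
theorem sign_mul_self (n : ℤ) : (-1 : k) ^ n * (-1 : k) ^ n = 1 := by
  rw [← mul_zpow]; simp

/-- The shift `M[n]`, with `M[n]^m = M^(m + n)`. -/
@[reducible]
def shift (M : Bimodule k B C) (n : ℤ) : Bimodule k B C where
  obj b c m := M.obj b c (m + n)
  d {_ _ p q} h := (-1 : k) ^ n • M.d (show p + n + 1 = q + n by omega)
  lact {_ _ _ p q r} h := (-1 : k) ^ (n * p) • M.lact (show p + (q + n) = r + n by omega)
  ract {_ _ _ p q r} h := M.ract (show p + n + q = r + n by omega)
  d_d h h' x := by simp [M.d_d]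
  d_lact {_ _ _ p q r p' q' r'} h hp hq hr h₁ h₂ f x := by
    subst hp
    have e : (-1 : k) ^ (n * (p + 1)) = (-1) ^ n * (-1) ^ (n * p) := by
      rw [← zpow_add₀ (by simp)]; congr 1; ring
    simp only [LinearMap.smul_apply, map_smul]
    rw [M.d_lact (p' := p + 1) (q' := q' + n) _ rfl (by omega) _ (by omega) (by omega), e]
    simp only [smul_add, smul_smul]
    congr 2
    all_goals ring
  d_ract {_ _ _ p q r p' q' r'} h hp hq hr h₁ h₂ x f := by
    have e : (-1 : k) ^ (p + n) = (-1) ^ p * (-1) ^ n := zpow_add₀ (by simp) _ _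
    simp only [LinearMap.smul_apply, map_smul]
    rw [M.d_ract (p' := p' + n) (q' := q') _ (by omega) hq _ (by omega) (by omega), e]
    simp only [smul_add, smul_smul]
    rw [mul_comm, mul_assoc, sign_mul_self, mul_one]
  one_lact h x := by simpa using M.one_lact _ x
  ract_one {_ _ p} h x := by
    have := M.ract_one (show p + n + 0 = p + n by omega) x
    exact this
  comp_lact {_ _ _ _ p q r pq qr s} hpq hqr h₁ h₂ g f x := by
    subst hpq
    have e : (-1 : k) ^ (n * (p + q)) = (-1) ^ (n * p) * (-1) ^ (n * q) := by
      rw [← zpow_add₀ (by simp)]; congr 1; ring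
    simp only [LinearMap.smul_apply, map_smul]
    rw [M.comp_lact (qr := qr + n) rfl (by omega) _ (by omega), e, smul_smul, mul_comm]
  ract_comp {_ _ _ _ p q r pq qr s} hpq hqr h₁ h₂ x g f :=
    M.ract_comp _ _ _ _ x g f
  lact_ract {_ _ _ _ p q r pq qr s} hpq hqr h₁ h₂ g x f := by
    simp only [LinearMap.smul_apply, map_smul]
    rw [M.lact_ract (qr := qr + n) _ (by omega) _ (by omega)]

/-- The mapping cone of `φ : M ⟶ N`: `cone φ ^ n = M^(n+1) × N^n` with differential
`(x, y) ↦ (-d x, φ x + d y)`. -/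
@[reducible]
def cone {M N : Bimodule k B C} (φ : M ⟶ N) : Bimodule k B C where
  obj b c n := M.obj b c (n + 1) × N.obj b c n
  d {b c p q} h := LinearMap.prod
    (-(M.d (show p + 1 + 1 = q + 1 by omega)) ∘ₗ LinearMap.fst k _ _)
    (φ.appOf b c h ∘ₗ LinearMap.fst k _ _ + N.d h ∘ₗ LinearMap.snd k _ _)
  lact {_ _ _ p q r} h := LinearMap.mk₂ k
    (fun f x => ((-1 : k) ^ p • M.lact (show p + (q + 1) = r + 1 by omega) f x.1, N.lact h f x.2))
    (fun f f' x => by simp) (fun a f x => by simp [smul_comm a])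
    (fun f x x' => by simp) (fun a f x => by simp [smul_comm a])
  ract {_ _ _ p q r} h := LinearMap.mk₂ k
    (fun x f => (M.ract (show p + 1 + q = r + 1 by omega) x.1 f, N.ract h x.2 f))
    (fun x x' f => by simp) (fun a x f => by simp)
    (fun x f f' => by simp) (fun a x f => by simp)
  d_d {b c p q r} h h' x := by
    subst h; subst h'
    ext
    · simp [M.d_d]
    · simp [N.d_d, φ.app_d]
  d_lact {_ _ _ p q r p' q' r'} h hp hq hr h₁ h₂ f x := by
    subst hp hq hr
    have e : (-1 : k) ^ (p + 1) = -(-1) ^ p := by rw [zpow_add₀ (by simp)]; simp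
    ext
    · simp [M.d_lact (p' := p + 1) (q' := q + 1 + 1) _ rfl rfl _
        (show p + 1 + (q + 1) = r + 1 + 1 by omega)
        (show p + (q + 1 + 1) = r + 1 + 1 by omega), e, smul_smul, sign_mul_self]
      abel
    · simp [N.d_lact (p' := p + 1) (q' := q + 1) _ rfl rfl _ h₁ h₂, φ.app_lact, smul_smul,
        sign_mul_self]
      abel
  d_ract {_ _ _ p q r p' q' r'} h hp hq hr h₁ h₂ x f := by
    subst hp hq hr
    have e : (-1 : k) ^ (p + 1) = -(-1) ^ p := by rw [zpow_add₀ (by simp)]; simp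
    ext
    · simp [M.d_ract (p' := p + 1 + 1) (q' := q + 1) _ rfl rfl _
        (show p + 1 + 1 + q = r + 1 + 1 by omega)
        (show p + 1 + (q + 1) = r + 1 + 1 by omega), e]
      abel
    · simp [N.d_ract (p' := p + 1) (q' := q + 1) _ rfl rfl _ h₁ h₂, φ.app_ract]
      abel
  one_lact h x := by
    ext
    · simp [M.one_lact]
    · simp [N.one_lact]
  ract_one {_ _ p} h x := by
    ext
    · exact M.ract_one (show p + 1 + 0 = p + 1 by omega) x.1
    · exact N.ract_one h x.2
  comp_lact {_ _ _ _ p q r pq qr s} hpq hqr h₁ h₂ g f x := by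
    subst hpq
    have e : (-1 : k) ^ (p + q) = (-1) ^ p * (-1) ^ q := zpow_add₀ (by simp) _ _
    ext
    · simp [M.comp_lact (qr := qr + 1) rfl (show q + (r + 1) = qr + 1 by omega)
        (show p + q + (r + 1) = s + 1 by omega) (by omega), e, smul_smul]
    · exact N.comp_lact rfl hqr h₁ h₂ g f x.2
  ract_comp {_ _ _ _ p q r pq qr s} hpq hqr h₁ h₂ x g f := by
    ext
    · exact M.ract_comp _ _ _ _ x.1 g f
    · exact N.ract_comp _ _ _ _ x.2 g f
  lact_ract {_ _ _ _ p q r pq qr s} hpq hqr h₁ h₂ g x f := by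
    ext
    · simp [M.lact_ract (qr := qr + 1) (show p + (q + 1) = pq + 1 by omega)
        (show q + 1 + r = qr + 1 by omega) (show pq + 1 + r = s + 1 by omega) (by omega)]
    · exact N.lact_ract hpq hqr h₁ h₂ g x.2 f

/-- The direct sum of two bimodules. -/
@[reducible]
def prod (M N : Bimodule k B C) : Bimodule k B C where
  obj b c n := M.obj b c n × N.obj b c n
  d h := LinearMap.prodMap (M.d h) (N.d h)
  lact h := LinearMap.mk₂ k (fun f x => (M.lact h f x.1, N.lact h f x.2))
    (fun f f' x => by simp) (fun a f x => by simp)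
    (fun f x x' => by simp) (fun a f x => by simp)
  ract h := LinearMap.mk₂ k (fun x f => (M.ract h x.1 f, N.ract h x.2 f))
    (fun x x' f => by simp) (fun a x f => by simp)
    (fun x f f' => by simp) (fun a x f => by simp)
  d_d h h' x := Prod.ext (M.d_d h h' x.1) (N.d_d h h' x.2)
  d_lact h hp hq hr h₁ h₂ f x :=
    Prod.ext (M.d_lact h hp hq hr h₁ h₂ f x.1) (N.d_lact h hp hq hr h₁ h₂ f x.2)
  d_ract h hp hq hr h₁ h₂ x f :=
    Prod.ext (M.d_ract h hp hq hr h₁ h₂ x.1 f) (N.d_ract h hp hq hr h₁ h₂ x.2 f)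
  one_lact h x := Prod.ext (M.one_lact h x.1) (N.one_lact h x.2)
  ract_one h x := Prod.ext (M.ract_one h x.1) (N.ract_one h x.2)
  comp_lact hpq hqr h₁ h₂ g f x :=
    Prod.ext (M.comp_lact hpq hqr h₁ h₂ g f x.1) (N.comp_lact hpq hqr h₁ h₂ g f x.2)
  ract_comp hpq hqr h₁ h₂ x g f :=
    Prod.ext (M.ract_comp hpq hqr h₁ h₂ x.1 g f) (N.ract_comp hpq hqr h₁ h₂ x.2 g f)
  lact_ract hpq hqr h₁ h₂ g x f :=
    Prod.ext (M.lact_ract hpq hqr h₁ h₂ g x.1 f) (N.lact_ract hpq hqr h₁ h₂ g x.2 f)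

/-- The direct sum of a (possibly infinite) family of bimodules. -/
@[reducible]
def directSum {I : Type u} (M : I → Bimodule k B C) : Bimodule k B C where
  obj b c n := ⨁ i, (M i).obj b c n
  d h := DirectSum.lmap fun i => (M i).d h
  lact h := LinearMap.mk₂ k (fun f x => DirectSum.lmap (fun i => (M i).lact h f) x)
    (fun f f' x => DFinsupp.ext fun i => by simp) (fun a f x => DFinsupp.ext fun i => by
      rw [DirectSum.smul_apply]; simp)
    (fun f x x' => map_add _ _ _) (fun a f x => map_smul _ _ _)
  ract h := LinearMap.mk₂ k (fun x f => DirectSum.lmap (fun i => ((M i).ract h).flip f) x)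
    (fun x x' f => map_add _ _ _) (fun a x f => map_smul _ _ _)
    (fun x f f' => DFinsupp.ext fun i => by simp) (fun a x f => DFinsupp.ext fun i => by
      rw [DirectSum.smul_apply]; simp)
  d_d h h' x := DFinsupp.ext fun i => (M i).d_d h h' (x i)
  d_lact h hp hq hr h₁ h₂ f x := DFinsupp.ext fun i => (M i).d_lact h hp hq hr h₁ h₂ f (x i)
  d_ract h hp hq hr h₁ h₂ x f := DFinsupp.ext fun i => (M i).d_ract h hp hq hr h₁ h₂ (x i) f
  one_lact h x := DFinsupp.ext fun i => (M i).one_lact h (x i)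
  ract_one h x := DFinsupp.ext fun i => (M i).ract_one h (x i)
  comp_lact hpq hqr h₁ h₂ g f x :=
    DFinsupp.ext fun i => (M i).comp_lact hpq hqr h₁ h₂ g f (x i)
  ract_comp hpq hqr h₁ h₂ x g f :=
    DFinsupp.ext fun i => (M i).ract_comp hpq hqr h₁ h₂ (x i) g f
  lact_ract hpq hqr h₁ h₂ g x f :=
    DFinsupp.ext fun i => (M i).lact_ract hpq hqr h₁ h₂ g (x i) f

/-! ## tensor products -/

/-- Index of a summand `F a b p ⊗ K b c q` of degree `n = p + q` of the tensor product. -/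
structure TensorIndex (B : Type u) (n : ℤ) where
  b : B
  p : ℤ
  q : ℤ
  h : p + q = n

section TensorProduct

variable (F : Bimodule k A B) (K : Bimodule k B C)

/-- The graded `k`-linear tensor product: `⨁_{b, p + q = n} F a b p ⊗ K b c q`. -/
abbrev PreTensor (a : A) (c : C) (n : ℤ) : Type u :=
  ⨁ i : TensorIndex B n, (F.obj a i.b i.p ⊗[k] K.obj i.b c i.q)

open Classical in
/-- The pure tensor `x ⊗ y` in the graded `k`-linear tensor product. -/
noncomputable def preTmul (a : A) (b : B) (c : C) {p q n : ℤ} (h : p + q = n) :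
    F.obj a b p →ₗ[k] K.obj b c q →ₗ[k] PreTensor F K a c n :=
  (TensorProduct.mk k (F.obj a b p) (K.obj b c q)).compr₂
    (DirectSum.lof k (TensorIndex B n) (fun i => F.obj a i.b i.p ⊗[k] K.obj i.b c i.q) ⟨b, p, q, h⟩)

/-- The relations `x f ⊗ y = x ⊗ f y`. -/
def tensorRel (a : A) (c : C) (n : ℤ) : Submodule k (PreTensor F K a c n) :=
  Submodule.span k {z | ∃ (b b' : B) (p r q pr rq : ℤ) (hpr : p + r = pr) (hrq : r + q = rq)
    (h : pr + q = n) (h' : p + rq = n) (x : F.obj a b p) (f : DGCategory.Hom k b' b r)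
    (y : K.obj b' c q),
    z = preTmul F K a b' c h (F.ract hpr x f) y - preTmul F K a b c h' x (K.lact hrq f y)}

/-- The degree `n` part of `(F ⊗_B K)(a, c)`. -/
abbrev TensorObj (a : A) (c : C) (n : ℤ) : Type u :=
  PreTensor F K a c n ⧸ tensorRel F K a c n

/-- The pure tensor `x ⊗ y` in `F ⊗_B K`. -/
noncomputable def tmul (a : A) (b : B) (c : C) {p q n : ℤ} (h : p + q = n) :
    F.obj a b p →ₗ[k] K.obj b c q →ₗ[k] TensorObj F K a c n :=
  (preTmul F K a b c h).compr₂ (tensorRel F K a c n).mkQ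

variable {F K}

theorem tmul_ract {a : A} {b b' : B} {c : C} {p r q pr rq n : ℤ} (hpr : p + r = pr)
    (hrq : r + q = rq) (h : pr + q = n) (h' : p + rq = n) (x : F.obj a b p)
    (f : DGCategory.Hom k b' b r) (y : K.obj b' c q) :
    tmul F K a b' c h (F.ract hpr x f) y = tmul F K a b c h' x (K.lact hrq f y) :=
  (Submodule.Quotient.eq _).2
    (Submodule.subset_span ⟨b, b', p, r, q, pr, rq, hpr, hrq, h, h', x, f, y, rfl⟩)

/-- Linear maps out of `F ⊗_B K` that agree on pure tensors are equal. -/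
theorem tensor_ext {a : A} {c : C} {n : ℤ} {X : Type u} [AddCommGroup X] [Module k X]
    {φ ψ : TensorObj F K a c n →ₗ[k] X}
    (H : ∀ (b : B) (p q : ℤ) (h : p + q = n) (x : F.obj a b p) (y : K.obj b c q),
      φ (tmul F K a b c h x y) = ψ (tmul F K a b c h x y)) : φ = ψ := by
  classical
  refine Submodule.linearMap_qext _ (DirectSum.linearMap_ext k fun i => ?_)
  obtain ⟨b, p, q, h⟩ := i
  refine TensorProduct.ext' fun x y => ?_
  exact H b p q h x y

open Classical in
/-- The universal property of `F ⊗_B K`: balanced bilinear maps induce linear maps. -/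
noncomputable def tensorLift {a : A} {c : C} {n : ℤ} {X : Type u} [AddCommGroup X] [Module k X]
    (β : ∀ (b : B) (p q : ℤ), p + q = n → (F.obj a b p →ₗ[k] K.obj b c q →ₗ[k] X))
    (hβ : ∀ (b b' : B) (p r q pr rq : ℤ) (hpr : p + r = pr) (hrq : r + q = rq)
      (h : pr + q = n) (h' : p + rq = n) (x : F.obj a b p) (f : DGCategory.Hom k b' b r)
      (y : K.obj b' c q),
      β b' pr q h (F.ract hpr x f) y = β b p rq h' x (K.lact hrq f y)) :
    TensorObj F K a c n →ₗ[k] X :=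
  (tensorRel F K a c n).liftQ
    (DirectSum.toModule k (TensorIndex B n) X
      (fun i => TensorProduct.lift (β i.b i.p i.q i.h)))
    (Submodule.span_le.2 (by
      rintro z ⟨b, b', p, r, q, pr, rq, hpr, hrq, h, h', x, f, y, rfl⟩
      simp [preTmul, hβ b b' p r q pr rq hpr hrq h h' x f y]))

@[simp]
theorem tensorLift_tmul {a : A} {c : C} {n : ℤ} {X : Type u} [AddCommGroup X] [Module k X]
    (β : ∀ (b : B) (p q : ℤ), p + q = n → (F.obj a b p →ₗ[k] K.obj b c q →ₗ[k] X))
    (hβ : ∀ (b b' : B) (p r q pr rq : ℤ) (hpr : p + r = pr) (hrq : r + q = rq)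
      (h : pr + q = n) (h' : p + rq = n) (x : F.obj a b p) (f : DGCategory.Hom k b' b r)
      (y : K.obj b' c q),
      β b' pr q h (F.ract hpr x f) y = β b p rq h' x (K.lact hrq f y))
    (b : B) {p q : ℤ} (h : p + q = n) (x : F.obj a b p) (y : K.obj b c q) :
    tensorLift β hβ (tmul F K a b c h x y) = β b p q h x y := by
  classical
  change DirectSum.toModule k (TensorIndex B n) X
      (fun i => TensorProduct.lift (β i.b i.p i.q i.h)) (preTmul F K a b c h x y) = _
  simp [preTmul]

variable (F K)

/-- The differential of `F ⊗_B K`: `d (x ⊗ y) = d x ⊗ y + (-1)^|x| x ⊗ d y`. -/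
noncomputable def tensorD (a : A) (c : C) {n m : ℤ} (hnm : n + 1 = m) :
    TensorObj F K a c n →ₗ[k] TensorObj F K a c m :=
  tensorLift
    (fun b p q h =>
      (tmul F K a b c (show (p + 1) + q = m by omega)).comp (F.d rfl) +
        (-1 : k) ^ p • (tmul F K a b c (show p + (q + 1) = m by omega)).compl₂ (K.d rfl))
    (by
      intro b b' p r q pr rq hpr hrq h h' x f y
      subst hpr hrq
      have e : (-1 : k) ^ (p + r) = (-1) ^ p * (-1) ^ r := zpow_add₀ (by simp) _ _
      simp only [LinearMap.add_apply, LinearMap.comp_apply, LinearMap.smul_apply,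
        LinearMap.compl₂_apply]
      rw [F.d_ract (p' := p + 1) (q' := r + 1) rfl rfl rfl rfl (by omega) (by omega),
        K.d_lact (p' := r + 1) (q' := q + 1) rfl rfl rfl rfl (by omega) (by omega)]
      simp only [map_add, map_smul, LinearMap.add_apply, LinearMap.smul_apply, smul_add, smul_smul]
      rw [tmul_ract (rq := r + q) _ rfl _ (by omega),
        tmul_ract (rq := r + q + 1) _ (by omega) _ (by omega),
        tmul_ract (rq := r + q + 1) _ (by omega) _ (by omega), e]
      rw [add_assoc])

@[simp]
theorem tensorD_tmul {a : A} {b : B} {c : C} {n m p q p' q' : ℤ} (hnm : n + 1 = m)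
    (h : p + q = n) (hp : p + 1 = p') (hq : q + 1 = q') (h₁ : p' + q = m) (h₂ : p + q' = m)
    (x : F.obj a b p) (y : K.obj b c q) :
    tensorD F K a c hnm (tmul F K a b c h x y) =
      tmul F K a b c h₁ (F.d hp x) y + (-1 : k) ^ p • tmul F K a b c h₂ x (K.d hq y) := by
  subst hp hq
  simp [tensorD]

/-- The left action on `F ⊗_B K`: `g (x ⊗ y) = g x ⊗ y`. -/
noncomputable def tensorLact {a a' : A} (c : C) {s n m : ℤ} (h : s + n = m) :
    DGCategory.Hom k a a' s →ₗ[k] TensorObj F K a c n →ₗ[k] TensorObj F K a' c m :=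
  LinearMap.mk₂ k
    (fun g z => tensorLift
      (fun b p q hpq => (tmul F K a' b c (show (s + p) + q = m by omega)).comp (F.lact rfl g))
      (by
        intro b b' p r q pr rq hpr hrq h h' x f y
        simp only [LinearMap.comp_apply]
        rw [← F.lact_ract (pq := s + p) rfl hpr (show s + p + r = s + pr by omega) rfl,
          tmul_ract (rq := rq) _ hrq _ (by omega)]) z)
    (fun g g' z => LinearMap.congr_fun (tensor_ext (ψ := _ + _) fun b p q h x y => by simp) z)
    (fun t g z => LinearMap.congr_fun (tensor_ext (ψ := t • _) fun b p q h x y => by simp) z)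
    (fun g z z' => map_add _ _ _) (fun t g z => map_smul _ _ _)

@[simp]
theorem tensorLact_tmul {a a' : A} {b : B} {c : C} {s n m p q sp : ℤ} (h : s + n = m)
    (hpq : p + q = n) (hsp : s + p = sp) (h₁ : sp + q = m) (g : DGCategory.Hom k a a' s)
    (x : F.obj a b p) (y : K.obj b c q) :
    tensorLact F K c h g (tmul F K a b c hpq x y) = tmul F K a' b c h₁ (F.lact hsp g x) y := by
  subst hsp
  simp [tensorLact]

/-- The right action on `F ⊗_B K`: `(x ⊗ y) g = x ⊗ y g`. -/
noncomputable def tensorRact (a : A) {c c' : C} {n s m : ℤ} (h : n + s = m) :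
    TensorObj F K a c n →ₗ[k] DGCategory.Hom k c' c s →ₗ[k] TensorObj F K a c' m :=
  (LinearMap.mk₂ k
    (fun g z => tensorLift
      (fun b p q hpq => (tmul F K a b c' (show p + (q + s) = m by omega)).compl₂
        ((K.ract rfl).flip g))
      (by
        intro b b' p r q pr rq hpr hrq h h' x f y
        simp only [LinearMap.compl₂_apply, LinearMap.flip_apply]
        rw [K.lact_ract (qr := q + s) hrq rfl rfl (show r + (q + s) = rq + s by omega),
          tmul_ract (rq := rq + s) hpr (by omega) _ (by omega)]) z)
    (fun g g' z => LinearMap.congr_fun (tensor_ext (ψ := _ + _) fun b p q h x y => by simp) z)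
    (fun t g z => LinearMap.congr_fun (tensor_ext (ψ := t • _) fun b p q h x y => by simp) z)
    (fun g z z' => map_add _ _ _) (fun t g z => map_smul _ _ _) :
    DGCategory.Hom k c' c s →ₗ[k] TensorObj F K a c n →ₗ[k] TensorObj F K a c' m).flip

@[simp]
theorem tensorRact_tmul {a : A} {b : B} {c c' : C} {s n m p q qs : ℤ} (h : n + s = m)
    (hpq : p + q = n) (hqs : q + s = qs) (h₁ : p + qs = m) (x : F.obj a b p) (y : K.obj b c q)
    (g : DGCategory.Hom k c' c s) :
    tensorRact F K a h (tmul F K a b c hpq x y) g = tmul F K a b c' h₁ x (K.ract hqs y g) := by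
  subst hqs
  simp [tensorRact]

/-- The tensor product `F ⊗_B K` of a bimodule over `A` and `B` with one over `B` and `C`. -/
@[reducible]
noncomputable def tensor : Bimodule k A C where
  obj a c n := TensorObj F K a c n
  d {a c _ _} h := tensorD F K a c h
  lact {_ _ c _ _ _} h := tensorLact F K c h
  ract {a _ _ _ _ _} h := tensorRact F K a h
  d_d {a c n₀ n₁ n₂} h h' z := by
    refine LinearMap.congr_fun (f := tensorD F K a c h' ∘ₗ tensorD F K a c h) (g := 0)
      (tensor_ext fun b p q hpq x y => ?_) z
    have e : (-1 : k) ^ (p + 1) = -(-1) ^ p := by rw [zpow_add₀ (by simp)]; simp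
    rw [LinearMap.comp_apply, tensorD_tmul F K h hpq rfl rfl (by omega) (by omega), map_add,
      map_smul, tensorD_tmul F K h' _ rfl rfl (by omega) (by omega),
      tensorD_tmul F K h' _ rfl rfl (by omega) (by omega)]
    simp [F.d_d, K.d_d, e]
  d_lact {a a' c s n m s' n' m'} h hs hn hm h₁ h₂ g z := by
    refine LinearMap.congr_fun (f := tensorD F K a' c hm ∘ₗ tensorLact F K c h g)
      (g := tensorLact F K c h₁ (DGCategory.d hs g) +
        (-1 : k) ^ s • (tensorLact F K c h₂ g ∘ₗ tensorD F K a c hn))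
      (tensor_ext fun b p q hpq x y => ?_) z
    subst hs
    have e : (-1 : k) ^ (s + p) = (-1) ^ s * (-1) ^ p := zpow_add₀ (by simp) _ _
    simp only [LinearMap.comp_apply, LinearMap.add_apply, LinearMap.smul_apply]
    rw [tensorLact_tmul F K h hpq rfl (by omega),
      tensorD_tmul F K hm _ rfl rfl (by omega) (by omega),
      tensorD_tmul F K hn _ rfl rfl (by omega) (by omega), map_add, map_smul,
      tensorLact_tmul (sp := s + p + 1) F K h₂ _ (by omega) (by omega),
      tensorLact_tmul F K h₂ _ rfl (by omega),
      F.d_lact (p' := s + 1) (q' := p + 1) rfl rfl rfl rfl (by omega) (by omega), e,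
      tensorLact_tmul (sp := s + p + 1) F K h₁ hpq (by omega) (by omega)]
    simp only [map_add, map_smul, LinearMap.add_apply, LinearMap.smul_apply, smul_add, smul_smul]
    exact add_assoc (G := TensorObj F K _ _ _) _ _ _
  d_ract {a c c' n s m n' s' m'} h hn hs hm h₁ h₂ z g := by
    refine LinearMap.congr_fun (f := tensorD F K a c' hm ∘ₗ (tensorRact F K a h).flip g)
      (g := (tensorRact F K a h₁).flip g ∘ₗ tensorD F K a c hn +
        (-1 : k) ^ n • (tensorRact F K a h₂).flip (DGCategory.d hs g))
      (tensor_ext fun b p q hpq x y => ?_) z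
    subst hs hpq
    have e : (-1 : k) ^ (p + q) = (-1) ^ p * (-1) ^ q := zpow_add₀ (by simp) _ _
    simp only [LinearMap.comp_apply, LinearMap.add_apply, LinearMap.smul_apply,
      LinearMap.flip_apply]
    rw [tensorRact_tmul F K h rfl rfl (by omega),
      tensorD_tmul F K hm _ rfl rfl (by omega) (by omega),
      tensorD_tmul F K hn _ rfl rfl (by omega) (by omega), map_add, map_smul,
      LinearMap.add_apply, LinearMap.smul_apply,
      tensorRact_tmul F K h₁ _ rfl (by omega),
      tensorRact_tmul (qs := q + s + 1) F K h₁ _ (by omega) (by omega),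
      tensorRact_tmul (qs := q + s + 1) F K h₂ _ (by omega) (by omega),
      K.d_ract (p' := q + 1) (q' := s + 1) rfl rfl rfl rfl (by omega) (by omega), e]
    simp only [map_add, map_smul, smul_add, smul_smul]
    exact (add_assoc (G := TensorObj F K _ _ _) _ _ _).symm
  one_lact {a c n} h z := by
    refine LinearMap.congr_fun (f := tensorLact F K c h (DGCategory.one a)) (g := LinearMap.id)
      (tensor_ext fun b p q hpq x y => ?_) z
    rw [tensorLact_tmul F K h hpq (zero_add p) hpq, F.one_lact, LinearMap.id_apply]
  ract_one {a c n} h z := by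
    refine LinearMap.congr_fun (f := (tensorRact F K a h).flip (DGCategory.one c))
      (g := LinearMap.id) (tensor_ext fun b p q hpq x y => ?_) z
    rw [LinearMap.flip_apply, tensorRact_tmul F K h hpq (add_zero q) hpq, K.ract_one,
      LinearMap.id_apply]
  comp_lact {a a' a'' c s t n st tn m} hst htn h₁ h₂ g f z := by
    refine LinearMap.congr_fun (f := tensorLact F K c h₁ (DGCategory.comp hst g f))
      (g := tensorLact F K c h₂ g ∘ₗ tensorLact F K c htn f)
      (tensor_ext fun b p q hpq x y => ?_) z
    subst hst
    rw [LinearMap.comp_apply, tensorLact_tmul F K h₁ hpq rfl (by omega),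
      tensorLact_tmul F K htn hpq rfl (by omega),
      tensorLact_tmul (sp := s + t + p) F K h₂ _ (by omega) (by omega),
      F.comp_lact rfl rfl rfl (by omega)]
  ract_comp {a c c' c'' n s t ns st m} hns hst h₁ h₂ z g f := by
    refine LinearMap.congr_fun
      (f := (tensorRact F K a h₁).flip f ∘ₗ (tensorRact F K a hns).flip g)
      (g := (tensorRact F K a h₂).flip (DGCategory.comp hst g f))
      (tensor_ext fun b p q hpq x y => ?_) z
    subst hst
    simp only [LinearMap.comp_apply, LinearMap.flip_apply]
    rw [tensorRact_tmul F K hns hpq rfl (by omega),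
      tensorRact_tmul F K h₁ _ rfl (by omega),
      tensorRact_tmul (qs := q + s + t) F K h₂ _ (by omega) (by omega),
      K.ract_comp rfl rfl rfl (by omega)]
  lact_ract {a a' c c' s n t sn nt m} hsn hnt h₁ h₂ g z f := by
    refine LinearMap.congr_fun
      (f := (tensorRact F K a' h₁).flip f ∘ₗ tensorLact F K c hsn g)
      (g := tensorLact F K c' h₂ g ∘ₗ (tensorRact F K a hnt).flip f)
      (tensor_ext fun b p q hpq x y => ?_) z
    simp only [LinearMap.comp_apply, LinearMap.flip_apply]
    rw [tensorLact_tmul F K hsn hpq rfl (by omega), tensorRact_tmul F K h₁ _ rfl (by omega),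
      tensorRact_tmul F K hnt hpq rfl (by omega), tensorLact_tmul F K h₂ _ rfl (by omega)]

variable {F K}

/-- The components of `φ ⊗ ψ`. -/
noncomputable def tensorMapApp {F' : Bimodule k A B} {K' : Bimodule k B C} (φ : BimoduleHom F F')
    (ψ : BimoduleHom K K') (a : A) (c : C) (n : ℤ) :
    TensorObj F K a c n →ₗ[k] TensorObj F' K' a c n :=
  tensorLift
    (fun b p q h => (tmul F' K' a b c h).compl₁₂ (φ.app a b p) (ψ.app b c q))
    (by
      intro b b' p r q pr rq hpr hrq h h' x f y
      simp only [LinearMap.compl₁₂_apply]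
      rw [φ.app_ract, ψ.app_lact, tmul_ract _ hrq _ h'])

@[simp]
theorem tensorMapApp_tmul {F' : Bimodule k A B} {K' : Bimodule k B C} (φ : BimoduleHom F F')
    (ψ : BimoduleHom K K') {a : A} {b : B} {c : C} {p q n : ℤ} (h : p + q = n)
    (x : F.obj a b p) (y : K.obj b c q) :
    tensorMapApp φ ψ a c n (tmul F K a b c h x y) =
      tmul F' K' a b c h (φ.app a b p x) (ψ.app b c q y) := by
  simp [tensorMapApp]

/-- The morphism `φ ⊗ ψ : F ⊗_B K ⟶ F' ⊗_B K'`, `x ⊗ y ↦ φ x ⊗ ψ y`. -/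
noncomputable def tensorMap {F' : Bimodule k A B} {K' : Bimodule k B C} (φ : F ⟶ F')
    (ψ : K ⟶ K') : tensor F K ⟶ tensor F' K' where
  app a c n := tensorMapApp φ ψ a c n
  app_d {a c n m} hnm z := by
    refine LinearMap.congr_fun (f := tensorMapApp φ ψ a c m ∘ₗ tensorD F K a c hnm)
      (g := tensorD F' K' a c hnm ∘ₗ tensorMapApp φ ψ a c n)
      (tensor_ext fun b p q h x y => ?_) z
    rw [LinearMap.comp_apply, LinearMap.comp_apply,
      tensorD_tmul F K hnm h rfl rfl (by omega) (by omega), map_add, map_smul,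
      tensorMapApp_tmul, tensorMapApp_tmul, tensorMapApp_tmul,
      tensorD_tmul F' K' hnm h rfl rfl (by omega) (by omega), φ.app_d, ψ.app_d]
  app_lact {a a' c s n m} hs g z := by
    refine LinearMap.congr_fun (f := tensorMapApp φ ψ a' c m ∘ₗ tensorLact F K c hs g)
      (g := tensorLact F' K' c hs g ∘ₗ tensorMapApp φ ψ a c n)
      (tensor_ext fun b p q h x y => ?_) z
    rw [LinearMap.comp_apply, LinearMap.comp_apply, tensorLact_tmul F K hs h rfl (by omega),
      tensorMapApp_tmul, tensorMapApp_tmul, tensorLact_tmul F' K' hs h rfl (by omega), φ.app_lact]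
  app_ract {a c c' n s m} hs z g := by
    refine LinearMap.congr_fun
      (f := tensorMapApp φ ψ a c' m ∘ₗ (tensorRact F K a hs).flip g)
      (g := (tensorRact F' K' a hs).flip g ∘ₗ tensorMapApp φ ψ a c n)
      (tensor_ext fun b p q h x y => ?_) z
    rw [LinearMap.comp_apply, LinearMap.comp_apply, LinearMap.flip_apply, LinearMap.flip_apply,
      tensorRact_tmul F K hs h rfl (by omega), tensorMapApp_tmul, tensorMapApp_tmul,
      tensorRact_tmul F' K' hs h rfl (by omega), ψ.app_ract]

end TensorProduct

/-! ## product bimodules -/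

/-- The product bimodule `(G₁ ⊠ G₂)(b, c) = G₁ b ⊗_k G₂ c` (the tensor product over the unit dg
category `k`). -/
noncomputable abbrev boxProd (G₁ : LeftModule k B) (G₂ : RightModule k C) : Bimodule k B C :=
  tensor G₁ G₂

/-- The product morphism `φ₁ ⊠ φ₂`. -/
noncomputable abbrev boxMap {G₁ G₁' : LeftModule k B} {G₂ G₂' : RightModule k C}
    (φ₁ : G₁ ⟶ G₁') (φ₂ : G₂ ⟶ G₂') : boxProd G₁ G₂ ⟶ boxProd G₁' G₂' :=
  tensorMap φ₁ φ₂

/-! ## perfect modules and derived convolution -/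

/-- A morphism of the unit dg category, as an element of `k`. -/
def unitVal {a a' : Pt.{u}} (p : ℤ) : DGCategory.Hom k a a' p →ₗ[k] k :=
  (unitDeg k p).subtype

/-- The element of `Hom X X p` given by `l ∈ k` placed in degree zero: `l • 1` if `p = 0`, and `0`
otherwise. -/
def scalarHom {a a' : Pt.{u}} (X : C) (p : ℤ) :
    DGCategory.Hom k a a' p →ₗ[k] DGCategory.Hom k X X p :=
  if hp : p = 0 then (unitVal p).smulRight (hp ▸ DGCategory.one X) else 0

theorem scalarHom_zero {a a' : Pt.{u}} (X : C) (l : DGCategory.Hom k a a' 0) :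
    scalarHom X 0 l = unitVal 0 l • DGCategory.one X := rfl

theorem scalarHom_of_ne {a a' : Pt.{u}} (X : C) {p : ℤ} (hp : p ≠ 0)
    (l : DGCategory.Hom k a a' p) : scalarHom X p l = 0 := by
  simp [scalarHom, hp]

theorem d_one (X : C) {q : ℤ} (h : 0 + 1 = q) :
    DGCategory.d h (DGCategory.one (k := k) X) = 0 := by
  subst h
  have := DGCategory.d_comp (k := k) (r := 0) (p' := 1) (q' := 1) (r' := 1) rfl rfl rfl rfl rfl rfl
    (DGCategory.one X) (DGCategory.one X)
  rw [DGCategory.one_comp, DGCategory.one_comp, DGCategory.comp_one] at this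
  simpa using this

theorem scalarHom_d {a a' : Pt.{u}} (X : C) {p q : ℤ} (h : p + 1 = q)
    (l : DGCategory.Hom k a a' p) : DGCategory.d h (scalarHom X p l) = 0 := by
  by_cases hp : p = 0
  · subst hp
    rw [scalarHom_zero, map_smul, d_one, smul_zero]
  · rw [scalarHom_of_ne X hp, map_zero]

theorem scalarHom_comp {a a' a'' : Pt.{u}} (X : C) {p q r : ℤ} (h : p + q = r)
    (l : DGCategory.Hom k a' a'' p) (m : DGCategory.Hom k a a' q) :
    scalarHom X r (DGCategory.comp h l m) =
      DGCategory.comp h (scalarHom X p l) (scalarHom X q m) := by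
  by_cases hp : p = 0
  · by_cases hq : q = 0
    · subst hp hq
      obtain rfl : r = 0 := by omega
      rw [scalarHom_zero, scalarHom_zero, scalarHom_zero, map_smul, map_smul,
        LinearMap.smul_apply, DGCategory.one_comp, smul_smul, mul_comm]
      rfl
    · rw [scalarHom_of_ne X hq, scalarHom_of_ne X (by omega), map_zero]
  · by_cases hr : r = 0
    · have hq : q ≠ 0 := by omega
      have : m = 0 := Subtype.ext (m.2 hq)
      rw [this, map_zero, map_zero, map_zero, map_zero]
    · rw [scalarHom_of_ne X hp, scalarHom_of_ne X hr, map_zero, LinearMap.zero_apply]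

/-- The representable right module `Hom(-, X)`; `k` acts on the left by scalars. -/
@[reducible]
def representable (k : Type u) [Field k] {C : Type u} [DGCategory k C] (X : C) :
    RightModule k C where
  obj _ c n := DGCategory.Hom k c X n
  d h := DGCategory.d h
  lact {_ _ _ p _ _} h := DGCategory.comp h ∘ₗ scalarHom X p
  ract h := DGCategory.comp h
  d_d h h' x := DGCategory.d_d h h' x
  d_lact h hp hq hr h₁ h₂ l x := by
    rw [LinearMap.comp_apply, LinearMap.comp_apply, LinearMap.comp_apply,
      DGCategory.d_comp h hp hq hr h₁ h₂, scalarHom_d, map_zero,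
      show DGCategory.d hp l = 0 from rfl, map_zero, map_zero]
  d_ract h hp hq hr h₁ h₂ x f := DGCategory.d_comp h hp hq hr h₁ h₂ x f
  one_lact h x := by
    rw [LinearMap.comp_apply, scalarHom_zero]
    exact (congrFun (congrArg _ (congrArg _ (one_smul k _))) x).trans (DGCategory.one_comp h x)
  ract_one h x := DGCategory.comp_one h x
  comp_lact hpq hqr h₁ h₂ g f x := by
    simp only [LinearMap.comp_apply]
    rw [scalarHom_comp, DGCategory.assoc]
  ract_comp hpq hqr h₁ h₂ x g f := DGCategory.assoc hpq hqr h₁ h₂ x g f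
  lact_ract hpq hqr h₁ h₂ g x f := DGCategory.assoc hpq hqr h₁ h₂ _ x f

/-- Perfect right modules, the objects of `Perf C`: the smallest class of right modules that
contains the representable and the acyclic modules and is closed under quasi-isomorphisms,
mapping cones, shifts, finite direct sums and direct summands. -/
inductive IsPerfect : RightModule k C → Prop
  | representable (X : C) : IsPerfect (representable k X)
  | acyclic {M : RightModule k C} : IsAcyclic M → IsPerfect M
  | quasiIso {M N : RightModule k C} : QuasiIsomorphic M N → IsPerfect M → IsPerfect N
  | cone {M N : RightModule k C} (φ : M ⟶ N) : IsPerfect M → IsPerfect N → IsPerfect (cone φ)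
  | shift {M : RightModule k C} (n : ℤ) : IsPerfect M → IsPerfect (shift M n)
  | prod {M N : RightModule k C} : IsPerfect M → IsPerfect N → IsPerfect (prod M N)
  | summand {M N : RightModule k C} : Retract M N → IsPerfect N → IsPerfect M

/-- The class `ads G`: the smallest class of right modules that contains `G` and is closed under
quasi-isomorphisms, (possibly infinite) direct sums, direct summands and shifts. -/
inductive Ads (G : RightModule k C) : RightModule k C → Prop
  | self : Ads G G
  | quasiIso {M N : RightModule k C} : QuasiIsomorphic M N → Ads G M → Ads G N
  | directSum {I : Type u} (M : I → RightModule k C) :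
      (∀ i, Ads G (M i)) → Ads G (directSum M)
  | summand {M N : RightModule k C} : Retract M N → Ads G N → Ads G M
  | shift {M : RightModule k C} (n : ℤ) : Ads G M → Ads G (shift M n)

/-- A right module `P` is h-flat if `P ⊗_B L` is acyclic for every acyclic left module `L`. -/
def IsHFlat (P : RightModule k B) : Prop :=
  ∀ L : LeftModule k B, IsAcyclic L → IsAcyclic (tensor P L)

/-- `T` is a value at `F` of the (derived) convolution functor
`Φ_K : D(B) ⥤ D(C)`, `F ↦ F ⊗_B^L K`: it is quasi-isomorphic to `P ⊗_B K` for some h-flat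
resolution `P ⟶ F`. -/
def IsConvolution (K : Bimodule k B C) (F : RightModule k B) (T : RightModule k C) : Prop :=
  ∃ P : RightModule k B, IsHFlat P ∧ (∃ s : P ⟶ F, IsQuasiIso s) ∧
    QuasiIsomorphic T (tensor P K)

/-- A bimodule `K` is weakly product if there is a perfect `G` such that `Φ_K F` lies in `ads G`
for all perfect `F`. -/
def IsWeaklyProduct (K : Bimodule k B C) : Prop :=
  ∃ G : RightModule k C, IsPerfect G ∧
    ∀ F : RightModule k B, IsPerfect F →
      ∀ T : RightModule k C, IsConvolution K F T → Ads G T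

end

end DG

namespace DG

section

variable {k : Type u} [Field k] {B C : Type u} [DGCategory k B] [DGCategory k C]

/-! ## morphisms -/

/-! Put `V = P ⊗ G₁` and `V' = P ⊗ G₁'`, tensored over the dg category. These are complexes of
`k`-vector spaces, and `1 ⊗ φ₁` gives a map `ψ : V ⟶ V'`. Tensoring with `P` commutes with cones
(`tensorConeIso`), and `P ⊗ (G₁ ⊠ G₂)` is `V ⊗_k G₂`, naturally in both factors (`assocRetract` with
its two naturality lemmas). So `P ⊗ cone (φ₁ ⊠ φ₂)` is controlled by `cone (ψ ⊗ φ₂)`, and the whole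
question concerns a map of complexes over a field tensored with a map of right modules.

Over a field every complex is homotopy equivalent to its cohomology, and the homotopy survives
tensoring with any right module (`exists_zeroDifferential_quasiIso`). Hence `ψ` may be replaced by a
map `θ : H ⟶ H'` of graded vector spaces. Such a map splits: `H` is kernel plus image, `H'` is image
plus cokernel, and `θ` is an isomorphism on the image. Accordingly `cone (θ ⊗ φ₂)` is the sum of
`(ker θ ⊗ G₂)[1]`, `im θ ⊗ cone φ₂` and `coker θ ⊗ G₂'`. The proof avoids naming the three pieces.
It uses a generalized inverse `g` of `θ` to exhibit the cone as a retract of `(H ⊗ G₂)[1] ⊕ cone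
(1_H ⊗ φ₂) ⊕ (H' ⊗ G₂')` (`ads_cone_tensorMap_of_zeroDifferential`).

Finally, a homogeneous basis of a graded vector space `H` makes `H ⊗ M` a direct sum of shifts of
`M` (`Ads.tensor`), so everything lies in the `ads` class of `G₂ ⊕ cone φ₂ ⊕ G₂'`. This module does
not depend on `P`, and it is perfect when `G₂` and `G₂'` are, so the bound for a single `F` also
yields the weakly product property. -/

@[simp]
theorem id_app (M : Bimodule k B C) (b : B) (c : C) (p : ℤ) (x : M.obj b c p) :
    BimoduleHom.app (𝟙 M) b c p x = x := rfl

@[simp]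
theorem comp_app {M N L : Bimodule k B C} (φ : M ⟶ N) (ψ : N ⟶ L) (b : B) (c : C) (p : ℤ)
    (x : M.obj b c p) :
    BimoduleHom.app (φ ≫ ψ) b c p x = BimoduleHom.app ψ b c p (BimoduleHom.app φ b c p x) := rfl

theorem hom_ext {M N : Bimodule k B C} {φ ψ : M ⟶ N}
    (h : ∀ b c p (x : M.obj b c p), BimoduleHom.app φ b c p x = BimoduleHom.app ψ b c p x) :
    φ = ψ :=
  BimoduleHom.ext (funext fun b => funext fun c => funext fun p => LinearMap.ext (h b c p))

/-! ### Actions of the unit dg category are scalar multiplication -/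

theorem unit_eq_smul_one {a : Pt.{u}} (f : DGCategory.Hom k a a 0) :
    f = unitVal 0 f • DGCategory.one (k := k) a :=
  Subtype.ext (mul_one f.1).symm

theorem lact_unit (M : Bimodule k Pt.{u} C) {a : Pt.{u}} {c : C} {q : ℤ} (h : 0 + q = q)
    (f : DGCategory.Hom k a a 0) (x : M.obj a c q) : M.lact h f x = unitVal 0 f • x := by
  conv_lhs => rw [unit_eq_smul_one f]
  rw [map_smul, LinearMap.smul_apply, M.one_lact]

theorem ract_unit (M : Bimodule k B Pt.{u}) {a : Pt.{u}} {b : B} {q : ℤ} (h : q + 0 = q)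
    (f : DGCategory.Hom k a a 0) (x : M.obj b a q) : M.ract h x f = unitVal 0 f • x := by
  conv_lhs => rw [unit_eq_smul_one f]
  rw [map_smul, M.ract_one]

/-- A morphism of the unit category is a scalar in degree 0 and vanishes in every other degree, so
equivariance is just `k`-linearity. This makes the left action invisible when morphisms of right
modules are built. -/
theorem map_lact_unit {M N : Bimodule k Pt.{u} C}
    (T : ∀ (a : Pt.{u}) (c : C) (p : ℤ), M.obj a c p →ₗ[k] N.obj a c p)
    {a a' : Pt.{u}} {c : C} {p q r : ℤ} (h : p + q = r) (f : DGCategory.Hom k a a' p)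
    (x : M.obj a c q) : T a' c r (M.lact h f x) = N.lact h f (T a c q x) := by
  cases a; cases a'
  by_cases hp : p = 0
  · subst hp
    obtain rfl : q = r := by omega
    rw [lact_unit, lact_unit, map_smul]
  · have hf : f = 0 := Subtype.ext (f.2 hp)
    rw [hf, map_zero, map_zero, LinearMap.zero_apply, LinearMap.zero_apply,
      map_zero]

theorem map_ract_unit {M N : Bimodule k B Pt.{u}}
    (T : ∀ (b : B) (a : Pt.{u}) (p : ℤ), M.obj b a p →ₗ[k] N.obj b a p)
    {a a' : Pt.{u}} {b : B} {p q r : ℤ} (h : p + q = r) (x : M.obj b a p)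
    (f : DGCategory.Hom k a' a q) : T b a' r (M.ract h x f) = N.ract h (T b a p x) f := by
  cases a; cases a'
  by_cases hq : q = 0
  · subst hq
    obtain rfl : p = r := by omega
    rw [ract_unit, ract_unit, map_smul]
  · have hf : f = 0 := Subtype.ext (f.2 hq)
    rw [hf, map_zero, map_zero, map_zero]

/-- A morphism of right modules; compatibility with the left action of `k` is automatic. -/
def homOfRight {M N : RightModule k C}
    (app : ∀ (b : Pt.{u}) (c : C) (p : ℤ), M.obj b c p →ₗ[k] N.obj b c p)
    (app_d : ∀ {b : Pt.{u}} {c : C} {p q : ℤ} (h : p + 1 = q) (x : M.obj b c p),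
      app b c q (M.d h x) = N.d h (app b c p x))
    (app_ract : ∀ {b : Pt.{u}} {c c' : C} {p q r : ℤ} (h : p + q = r) (x : M.obj b c p)
      (f : DGCategory.Hom k c' c q), app b c' r (M.ract h x f) = N.ract h (app b c p x) f) :
    M ⟶ N where
  app := app
  app_d := app_d
  app_lact := map_lact_unit app
  app_ract := app_ract

/-- A morphism of complexes over `k`. -/
def homOfLinear {M N : Bimodule k Pt.{u} Pt.{u}}
    (app : ∀ (b c : Pt.{u}) (p : ℤ), M.obj b c p →ₗ[k] N.obj b c p)
    (app_d : ∀ {b c : Pt.{u}} {p q : ℤ} (h : p + 1 = q) (x : M.obj b c p),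
      app b c q (M.d h x) = N.d h (app b c p x)) :
    M ⟶ N :=
  homOfRight app app_d (map_ract_unit app)

theorem isQuasiIso_id (M : Bimodule k B C) : IsQuasiIso (𝟙 M) := fun b c p q r hpq hqr =>
  ⟨fun _ _ h => h, fun y hy => ⟨y, hy, 0, by simp⟩⟩

/-! ### Functoriality of the cone -/

/-- A morphism of cones from a commutative square. -/
def coneMap {M N M' N' : Bimodule k B C} {φ : M ⟶ N} {φ' : M' ⟶ N'} (α : M ⟶ M') (β : N ⟶ N')
    (w : φ ≫ β = α ≫ φ') : cone φ ⟶ cone φ' where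
  app b c p := LinearMap.prodMap (α.app b c (p + 1)) (β.app b c p)
  app_d {b c p q} h x := by
    subst h
    have := LinearMap.congr_fun (congrFun (congrFun (congrFun
      (congrArg BimoduleHom.app w) b) c) (p + 1)) x.1
    ext
    · simp [α.app_d]
    · simpa [β.app_d] using this
  app_lact h f x := by
    ext
    · simp [α.app_lact]
    · simp [β.app_lact]
  app_ract h x f := by
    ext
    · simp [α.app_ract]
    · simp [β.app_ract]

@[simp]
theorem coneMap_app {M N M' N' : Bimodule k B C} {φ : M ⟶ N} {φ' : M' ⟶ N'} (α : M ⟶ M')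
    (β : N ⟶ N') (w : φ ≫ β = α ≫ φ') (b : B) (c : C) (p : ℤ) (x : (cone φ).obj b c p) :
    BimoduleHom.app (coneMap α β w) b c p x = (α.app b c (p + 1) x.1, β.app b c p x.2) := rfl

theorem cone_d_apply {M N : Bimodule k B C} (φ : M ⟶ N) {b : B} {c : C} {p : ℤ}
    (x : M.obj b c (p + 1)) (y : N.obj b c p) :
    (cone φ).d (rfl : p + 1 = p + 1) (b := b) (c := c) (x, y) =
      (-M.d rfl x, φ.app b c (p + 1) x + N.d rfl y) := rfl

theorem app_comm {M N M' N' : Bimodule k B C} {φ : M ⟶ N} {φ' : M' ⟶ N'} {α : M ⟶ M'}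
    {β : N ⟶ N'} (w : φ ≫ β = α ≫ φ') (b : B) (c : C) (n : ℤ) (x : M.obj b c n) :
    β.app b c n (φ.app b c n x) = φ'.app b c n (α.app b c n x) :=
  LinearMap.congr_fun (congrFun (congrFun (congrFun (congrArg BimoduleHom.app w) b) c) n) x

/-- This is the five lemma for the long exact sequences of the two cones, carried out as an explicit
diagram chase on elements. The first half proves injectivity on cohomology, the second surjectivity.
-/
theorem coneMap_isQuasiIso {M N M' N' : Bimodule k B C} {φ : M ⟶ N} {φ' : M' ⟶ N'} {α : M ⟶ M'}
    {β : N ⟶ N'} (w : φ ≫ β = α ≫ φ') (hα : IsQuasiIso α) (hβ : IsQuasiIso β) :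
    IsQuasiIso (coneMap α β w) := by
  intro b c p q r hpq hqr
  have comm := app_comm w b c
  subst hpq hqr
  constructor
  · rintro ⟨x, y⟩ hx ⟨⟨u, v⟩, huv⟩
    rw [cone_d_apply] at hx huv
    rw [coneMap_app] at huv
    have hx1 : M.d rfl x = 0 := neg_eq_zero.1 (congrArg Prod.fst hx)
    have hx2 : φ.app b c _ x + N.d rfl y = 0 := congrArg Prod.snd hx
    have h1 : -M'.d rfl u = α.app b c _ x := congrArg Prod.fst huv
    have h2 : φ'.app b c _ u + N'.d rfl v = β.app b c _ y := congrArg Prod.snd huv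
    -- Since `α x = d (-u)`, the class of `x` dies and `x = d x₀`. Any primitive `x₀` must then be
    -- corrected: `u + α x₀` is a cocycle, and a cocycle `x₁` of `M` represents it up to the
    -- boundary `d t`.
    obtain ⟨x₀, rfl⟩ := (hα b c (p + 1) (p + 1 + 1) _ rfl rfl).1 x hx1 ⟨-u, by rw [map_neg, h1]⟩
    obtain ⟨x₁, hx₁, t, ht⟩ := (hα b c p (p + 1) _ rfl rfl).2 (u + α.app b c _ x₀)
      (by rw [map_add, ← α.app_d, ← h1, add_neg_cancel])
    -- With first coordinate `-x₀ + x₁`, the second coordinate `n` of a primitive must satisfy `d n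
    -- = y + φ x₀ - φ x₁`. The correction by `x₁` is exactly what makes the image of the right side
    -- under `β` the boundary of `v - φ' t`.
    obtain ⟨n, hn⟩ := (hβ b c p (p + 1) _ rfl rfl).1 (y + φ.app b c _ x₀ - φ.app b c _ x₁)
      (by rw [map_sub, map_add, ← φ.app_d, ← φ.app_d, hx₁, map_zero, sub_zero,
        add_comm (N.d _ y), hx2])
      ⟨v - φ'.app b c _ t, by
        rw [map_sub, map_sub, map_add, comm, comm, ← h2, ← φ'.app_d, ht, map_sub, map_add]
        abel⟩
    refine ⟨(-x₀ + x₁, n), ?_⟩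
    rw [cone_d_apply, hn, map_add, map_add, hx₁, map_neg, map_neg]
    ext
    · simp
    · simp
  · rintro ⟨y₁, y₂⟩ hy
    rw [cone_d_apply] at hy
    have hy1 : M'.d rfl y₁ = 0 := neg_eq_zero.1 (congrArg Prod.fst hy)
    have hy2 : φ'.app b c _ y₁ + N'.d rfl y₂ = 0 := congrArg Prod.snd hy
    obtain ⟨x, hx, w, hw⟩ := (hα b c (p + 1) (p + 1 + 1) _ rfl rfl).2 y₁ hy1
    -- Extending `x` to a cocycle of `cone φ` requires `φ x` to be a boundary. Its image under `β`
    -- is one, because `φ' y₁ = -d y₂`.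
    obtain ⟨n, hn⟩ := (hβ b c (p + 1) (p + 1 + 1) _ rfl rfl).1 (φ.app b c _ x)
      (by rw [← φ.app_d, hx, map_zero])
      ⟨-y₂ + φ'.app b c _ w, by
        rw [map_add, ← φ'.app_d, hw, comm, map_sub, map_neg, eq_neg_of_add_eq_zero_left hy2]
        abel⟩
    -- The cocycle `(x, -n)` need not lie in the class of `(y₁, y₂)`. The discrepancy is the class
    -- of `β n + y₂ - φ' w` in `N'`, which lifts to a cocycle `n₁` of `N`.
    obtain ⟨n₁, hn₁, t, ht⟩ := (hβ b c p (p + 1) _ rfl rfl).2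
      (β.app b c _ n + y₂ - φ'.app b c _ w)
      (by rw [map_sub, map_add, ← β.app_d, hn, ← φ'.app_d, hw, comm, map_sub,
            eq_neg_of_add_eq_zero_left hy2]
          abel)
    refine ⟨(x, -n + n₁), ?_, (-w, t), ?_⟩
    · rw [cone_d_apply, hx, map_add, hn₁, map_neg, hn]
      ext <;> simp
    · rw [cone_d_apply, coneMap_app, ht, map_neg, map_neg, hw, map_add, map_neg]
      ext
      · simp
      · simp
        abel

/-- A retract of arrows induces a retract of cones. -/
def coneRetract {M N M' N' : Bimodule k B C} {φ : M ⟶ N} {φ' : M' ⟶ N'} (hM : Retract M M')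
    (hN : Retract N N') (wi : φ ≫ hN.i = hM.i ≫ φ') (wr : φ' ≫ hN.r = hM.r ≫ φ) :
    Retract (cone φ) (cone φ') where
  i := coneMap _ _ wi
  r := coneMap _ _ wr
  retract := hom_ext fun b c p x => by
    have h1 := LinearMap.congr_fun (congrFun (congrFun (congrFun
      (congrArg BimoduleHom.app hM.retract) b) c) (p + 1)) x.1
    have h2 := LinearMap.congr_fun (congrFun (congrFun (congrFun
      (congrArg BimoduleHom.app hN.retract) b) c) p) x.2
    exact Prod.ext h1 h2

/-! ## closure properties -/

theorem QuasiIsomorphic.of {M N : Bimodule k B C} {φ : M ⟶ N} (h : IsQuasiIso φ) :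
    QuasiIsomorphic M N := Relation.EqvGen.rel _ _ ⟨φ, h⟩

theorem QuasiIsomorphic.symm {M N : Bimodule k B C} (h : QuasiIsomorphic M N) :
    QuasiIsomorphic N M := Relation.EqvGen.symm _ _ h

/-- The morphism from a direct sum given by a family of morphisms. -/
def directSumDesc {I : Type u} [DecidableEq I] {M : I → Bimodule k B C} {X : Bimodule k B C}
    (f : ∀ i, M i ⟶ X) : directSum M ⟶ X where
  app b c p := DirectSum.toModule k I _ fun i => (f i).app b c p
  app_d {b c p q} h x := by
    refine LinearMap.congr_fun (f := (DirectSum.toModule k I _ fun i => (f i).app b c q) ∘ₗ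
      (directSum M).d h) (g := X.d h ∘ₗ DirectSum.toModule k I _ fun i => (f i).app b c p)
      (DirectSum.linearMap_ext k fun i => LinearMap.ext fun y => ?_) x
    simp [(f i).app_d]
  app_lact {b b' c p q r} h g x := by
    refine LinearMap.congr_fun (f := (DirectSum.toModule k I _ fun i => (f i).app b' c r) ∘ₗ
      (directSum M).lact h g) (g := X.lact h g ∘ₗ DirectSum.toModule k I _ fun i => (f i).app b c q)
      (DirectSum.linearMap_ext k fun i => LinearMap.ext fun y => ?_) x
    simp [(f i).app_lact]
  app_ract {b c c' p q r} h x g := by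
    refine LinearMap.congr_fun (f := (DirectSum.toModule k I _ fun i => (f i).app b c' r) ∘ₗ
      ((directSum M).ract h).flip g)
      (g := (X.ract h).flip g ∘ₗ DirectSum.toModule k I _ fun i => (f i).app b c p)
      (DirectSum.linearMap_ext k fun i => LinearMap.ext fun y => ?_) x
    simp [(f i).app_ract]

@[simp]
theorem directSumDesc_app_lof {I : Type u} [DecidableEq I] {M : I → Bimodule k B C}
    {X : Bimodule k B C} (f : ∀ i, M i ⟶ X) (i : I) (b : B) (c : C) (p : ℤ)
    (x : (M i).obj b c p) :
    (directSumDesc f).app b c p (DirectSum.lof k I (fun i => (M i).obj b c p) i x) =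
      (f i).app b c p x := by
  simp [directSumDesc]

/-- The inclusion of a summand of a direct sum. -/
def directSumι {I : Type u} [DecidableEq I] (M : I → Bimodule k B C) (i : I) :
    M i ⟶ directSum M where
  app b c p := DirectSum.lof k I (fun i => (M i).obj b c p) i
  app_d h x := by simp
  app_lact h f x := by simp
  app_ract h x f := by simp

/-- The morphism to the direct sum of two modules given by two morphisms. -/
def prodLift {M N X : Bimodule k B C} (f : X ⟶ M) (g : X ⟶ N) : X ⟶ prod M N where
  app b c p := LinearMap.prod (f.app b c p) (g.app b c p)
  app_d h x := by simp [f.app_d, g.app_d]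
  app_lact h a x := by simp [f.app_lact, g.app_lact]
  app_ract h x a := by simp [f.app_ract, g.app_ract]

/-- The morphism from the direct sum of two modules given by two morphisms. -/
def prodDesc {M N X : Bimodule k B C} (f : M ⟶ X) (g : N ⟶ X) : prod M N ⟶ X where
  app b c p := LinearMap.coprod (f.app b c p) (g.app b c p)
  app_d h x := by simp [f.app_d, g.app_d]
  app_lact h a x := by simp [f.app_lact, g.app_lact]
  app_ract h x a := by simp [f.app_ract, g.app_ract]

@[simp]
theorem prodLift_app {M N X : Bimodule k B C} (f : X ⟶ M) (g : X ⟶ N) (b : B) (c : C) (p : ℤ)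
    (x : X.obj b c p) :
    BimoduleHom.app (prodLift f g) b c p x = (f.app b c p x, g.app b c p x) := rfl

@[simp]
theorem prodDesc_app {M N X : Bimodule k B C} (f : M ⟶ X) (g : N ⟶ X) (b : B) (c : C) (p : ℤ)
    (x : (prod M N).obj b c p) :
    BimoduleHom.app (prodDesc f g) b c p x = f.app b c p x.1 + g.app b c p x.2 := rfl

/-- The zero morphism. -/
def zeroHom (M N : Bimodule k B C) : M ⟶ N where
  app _ _ _ := 0
  app_d _ _ := by simp
  app_lact _ _ _ := by simp
  app_ract _ _ _ := by simp

@[simp]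
theorem zeroHom_app (M N : Bimodule k B C) (b : B) (c : C) (p : ℤ) (x : M.obj b c p) :
    BimoduleHom.app (zeroHom M N) b c p x = 0 := rfl

/-- The first summand is a retract of a direct sum. -/
def retractProdLeft (M N : Bimodule k B C) : Retract M (prod M N) where
  i := prodLift (𝟙 M) (zeroHom M N)
  r := prodDesc (𝟙 M) (zeroHom N M)
  retract := hom_ext fun b c p x => by
    rw [comp_app, prodLift_app, prodDesc_app]; simp

/-- The second summand is a retract of a direct sum. -/
def retractProdRight (M N : Bimodule k B C) : Retract N (prod M N) where
  i := prodLift (zeroHom N M) (𝟙 N)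
  r := prodDesc (zeroHom M N) (𝟙 N)
  retract := hom_ext fun b c p x => by
    rw [comp_app, prodLift_app, prodDesc_app]; simp

/-- The family of two modules, indexed by Booleans. -/
abbrev pairFamily (M N : Bimodule k B C) (i : ULift.{u} Bool) : Bimodule k B C :=
  Bool.rec N M i.down

/-- The definition of `Ads` provides only indexed direct sums. A binary sum is a retract of the sum
over `ULift Bool`, and closure under summands makes a full isomorphism unnecessary. -/
theorem Ads.prod {G M N : RightModule k C} (hM : Ads G M) (hN : Ads G N) : Ads G (prod M N) := by
  classical
  refine Ads.summand (N := DG.directSum (pairFamily M N)) ⟨prodDesc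
      (directSumι (pairFamily M N) ⟨true⟩) (directSumι (pairFamily M N) ⟨false⟩),
    directSumDesc fun i => ?_, ?_⟩ (Ads.directSum _ ?_)
  · rcases i with ⟨_ | _⟩
    · exact (retractProdRight M N).i
    · exact (retractProdLeft M N).i
  · refine hom_ext fun b c p x => ?_
    rw [comp_app, prodDesc_app, map_add]
    erw [directSumDesc_app_lof, directSumDesc_app_lof]
    simp only [retractProdLeft, retractProdRight]
    rw [prodLift_app, prodLift_app]
    simp
    rfl
  · rintro ⟨_ | _⟩
    · exact hN
    · exact hM

end

section

variable {k : Type u} [Field k] {B C : Type u} [DGCategory k B] [DGCategory k C]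

/-! ## tensor products with cones -/

@[simp]
theorem tensorMap_app_tmul {A : Type u} [DGCategory k A] {F F' : Bimodule k A B}
    {K K' : Bimodule k B C} (φ : F ⟶ F')
    (ψ : K ⟶ K') {a : A} {b : B} {c : C} {p q n : ℤ} (h : p + q = n)
    (x : F.obj a b p) (y : K.obj b c q) :
    BimoduleHom.app (tensorMap φ ψ) a c n (tmul F K a b c h x y) =
      tmul F' K' a b c h (φ.app a b p x) (ψ.app b c q y) :=
  tensorMapApp_tmul φ ψ h x y

theorem tensorMap_comp {A : Type u} [DGCategory k A] {F F' F'' : Bimodule k A B}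
    {K K' K'' : Bimodule k B C} (φ : F ⟶ F')
    (ψ : K ⟶ K') (φ' : F' ⟶ F'') (ψ' : K' ⟶ K'') :
    tensorMap φ ψ ≫ tensorMap φ' ψ' = tensorMap (φ ≫ φ') (ψ ≫ ψ') :=
  BimoduleHom.ext (funext fun a => funext fun c => funext fun n =>
    tensor_ext fun b p q h x y => by
      change (tensorMap φ' ψ').app a c n ((tensorMap φ ψ).app a c n _) = _
      rw [tensorMap_app_tmul, tensorMap_app_tmul, tensorMap_app_tmul]
      rfl)

section Cone

variable {K L : Bimodule k B C} (P : RightModule k B) (χ : K ⟶ L)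

/-- The component of `P ⊗ cone χ ⟶ cone (P ⊗ χ)`. -/
noncomputable def tensorConeApp (a : Pt.{u}) (c : C) (n : ℤ) :
    TensorObj P (cone χ) a c n →ₗ[k] TensorObj P K a c (n + 1) × TensorObj P L a c n :=
  tensorLift
    (fun b p q h => LinearMap.mk₂ k
      -- The Koszul sign for moving the shift in the cone past `x`. The left action on the shifted
      -- part of the cone carries the same kind of sign, so the map is balanced only with this
      -- factor.
      (fun x y => ((-1 : k) ^ p • tmul P K a b c (show p + (q + 1) = n + 1 by omega) x y.1,
        tmul P L a b c h x y.2))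
      (fun x x' y => by simp) (fun t x y => by simp [smul_comm t])
      (fun x y y' => by simp) (fun t x y => by simp [smul_comm t]))
    (by
      intro b b' p r q pr rq hpr hrq h h' x f y
      subst hpr
      have e : (-1 : k) ^ (p + r) = (-1) ^ p * (-1) ^ r := zpow_add₀ (by simp) _ _
      ext
      · simp [tmul_ract (rq := rq + 1) rfl (show r + (q + 1) = rq + 1 by omega) _
          (show p + (rq + 1) = n + 1 by omega), e, mul_smul]
      · simp [tmul_ract rfl hrq h h'])

@[simp]
theorem tensorConeApp_tmul {a : Pt.{u}} {b : B} {c : C} {p q n : ℤ} (h : p + q = n)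
    (x : P.obj a b p) (y : (cone χ).obj b c q) :
    tensorConeApp P χ a c n (tmul P (cone χ) a b c h x y) =
      ((-1 : k) ^ p • tmul P K a b c (show p + (q + 1) = n + 1 by omega) x y.1,
        tmul P L a b c h x y.2) :=
  tensorLift_tmul _ _ b h x y

/-- The bilinear map `(x, y) ↦ (-1)^|x| x ⊗ (y, 0)` into `P ⊗ cone χ`. -/
noncomputable def coneTensorBilin (a : Pt.{u}) (c : C) {n : ℤ} (b : B) (p q : ℤ)
    (h : p + q = n + 1) : P.obj a b p →ₗ[k] K.obj b c q →ₗ[k] TensorObj P (cone χ) a c n :=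
  (-1 : k) ^ p • (tmul P (cone χ) a b c (show p + (q - 1) = n by omega)).compl₂
    (LinearMap.inl k _ _ ∘ₗ BimoduleHom.appOf (𝟙 K) b c (show q = q - 1 + 1 by omega))

/-- Frees the index `q - 1` to any `s` with `s + 1 = q`. When `q` is literally `s + 1`, the
transport in `appOf` disappears, which is why later arguments first write the degree of the
`K`-factor as a successor. -/
theorem coneTensorBilin_apply {a : Pt.{u}} {c : C} {n : ℤ} {b : B} {p q s : ℤ}
    (h : p + q = n + 1) (hs : s + 1 = q) (h' : p + s = n) (x : P.obj a b p) (y : K.obj b c q) :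
    coneTensorBilin P χ a c b p q h x y =
      (-1 : k) ^ p • tmul P (cone χ) a b c h' x (BimoduleHom.appOf (𝟙 K) b c hs.symm y, 0) := by
  obtain rfl : s = q - 1 := by omega
  rfl

/-- The component of `cone (P ⊗ χ) ⟶ P ⊗ cone χ` on `P ⊗ K`. -/
noncomputable def coneTensorFst (a : Pt.{u}) (c : C) (n : ℤ) :
    TensorObj P K a c (n + 1) →ₗ[k] TensorObj P (cone χ) a c n :=
  tensorLift (coneTensorBilin P χ a c)
    (by
      intro b b' p r q pr rq hpr hrq h h' x f y
      obtain ⟨q, rfl⟩ : ∃ q', q = q' + 1 := ⟨q - 1, by omega⟩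
      obtain ⟨rq, rfl⟩ : ∃ q', rq = q' + 1 := ⟨rq - 1, by omega⟩
      subst hpr
      have e : (-1 : k) ^ (p + r) = (-1) ^ p * (-1) ^ r := zpow_add₀ (by simp) _ _
      rw [coneTensorBilin_apply P χ h rfl (by omega), coneTensorBilin_apply P χ h' rfl (by omega),
        tmul_ract rfl (show r + q = rq by omega) _ (by omega), e, mul_smul, ← map_smul]
      congr 2
      ext
      · simp [smul_smul, sign_mul_self]
      · simp)

theorem coneTensorFst_tmul {a : Pt.{u}} {b : B} {c : C} {p q n : ℤ} (h : p + (q + 1) = n + 1)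
    (h' : p + q = n) (x : P.obj a b p) (y : K.obj b c (q + 1)) :
    coneTensorFst P χ a c n (tmul P K a b c h x y) =
      (-1 : k) ^ p • tmul P (cone χ) a b c h' x (y, 0) := by
  rw [coneTensorFst, tensorLift_tmul, coneTensorBilin_apply P χ h rfl h']
  rfl

/-- The component of `cone (P ⊗ χ) ⟶ P ⊗ cone χ` on `P ⊗ L`. -/
noncomputable def coneTensorSnd (a : Pt.{u}) (c : C) (n : ℤ) :
    TensorObj P L a c n →ₗ[k] TensorObj P (cone χ) a c n :=
  tensorLift
    (fun b p q h => (tmul P (cone χ) a b c h).compl₂ (LinearMap.inr k _ _))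
    (by
      intro b b' p r q pr rq hpr hrq h h' x f y
      simp only [LinearMap.compl₂_apply]
      rw [tmul_ract hpr hrq h h']
      congr 1
      ext <;> simp)

theorem coneTensorSnd_tmul {a : Pt.{u}} {b : B} {c : C} {p q n : ℤ} (h : p + q = n)
    (x : P.obj a b p) (y : L.obj b c q) :
    coneTensorSnd P χ a c n (tmul P L a b c h x y) = tmul P (cone χ) a b c h x (0, y) := by
  simp [coneTensorSnd]

/-- `P ⊗ cone χ ⟶ cone (P ⊗ χ)`. -/
noncomputable def tensorConeHom : tensor P (cone χ) ⟶ cone (tensorMap (𝟙 P) χ) :=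
  homOfRight (M := tensor P (cone χ)) (N := cone (tensorMap (𝟙 P) χ)) (tensorConeApp P χ)
    (by
      intro a c n m hnm z
      refine LinearMap.congr_fun (f := tensorConeApp P χ a c m ∘ₗ tensorD P (cone χ) a c hnm)
        (g := (cone (tensorMap (𝟙 P) χ)).d hnm ∘ₗ tensorConeApp P χ a c n)
        (tensor_ext fun b p q h x y => ?_) z
      subst hnm
      have e : (-1 : k) ^ (p + 1) = -(-1) ^ p := by rw [zpow_add₀ (by simp)]; simp
      rw [LinearMap.comp_apply, LinearMap.comp_apply, tensorD_tmul P (cone χ) rfl h rfl rfl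
        (by omega) (by omega), map_add, map_smul, tensorConeApp_tmul, tensorConeApp_tmul,
        tensorConeApp_tmul]
      change _ = (-tensorD P K a c (rfl : n + 1 + 1 = n + 1 + 1) ((-1 : k) ^ p •
          tmul P K a b c (show p + (q + 1) = n + 1 by omega) x y.1),
        BimoduleHom.app (tensorMap (𝟙 P) χ) a c (n + 1) ((-1 : k) ^ p •
          tmul P K a b c (show p + (q + 1) = n + 1 by omega) x y.1) +
        tensorD P L a c (rfl : n + 1 = n + 1) (tmul P L a b c h x y.2))
      rw [map_smul, map_smul, tensorD_tmul P K rfl _ rfl rfl (by omega) (by omega),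
        tensorD_tmul P L rfl _ rfl rfl (by omega) (by omega), tensorMap_app_tmul]
      ext
      · simp [e, smul_smul, sign_mul_self]
        abel
      · simp
        abel)
    (by
      intro a c c' n s m hs z f
      refine LinearMap.congr_fun (f := tensorConeApp P χ a c' m ∘ₗ
          (tensorRact P (cone χ) a hs).flip f)
        (g := ((cone (tensorMap (𝟙 P) χ)).ract hs).flip f ∘ₗ tensorConeApp P χ a c n)
        (tensor_ext fun b p q h x y => ?_) z
      rw [LinearMap.comp_apply, LinearMap.comp_apply, LinearMap.flip_apply, LinearMap.flip_apply,
        tensorRact_tmul P (cone χ) hs h rfl (by omega), tensorConeApp_tmul, tensorConeApp_tmul]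
      ext
      · simp [tensorRact_tmul P K (show n + 1 + s = m + 1 by omega)
          (show p + (q + 1) = n + 1 by omega) (show q + 1 + s = q + s + 1 by omega)
          (show p + (q + s + 1) = m + 1 by omega)]
      · simp [tensorRact_tmul P L hs h rfl (show p + (q + s) = m by omega)])

/-- The element `(z, 0)` of `cone (P ⊗ χ)` has differential `(-d z, (P ⊗ χ) z)`, so compatibility of
`coneTensorHom` with `d` on the shifted summand involves both components. -/
theorem coneTensorFst_d (a : Pt.{u}) (c : C) (n : ℤ) (z : TensorObj P K a c (n + 1)) :
    coneTensorFst P χ a c (n + 1) (-tensorD P K a c rfl z) +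
      coneTensorSnd P χ a c (n + 1) (BimoduleHom.app (tensorMap (𝟙 P) χ) a c (n + 1) z) =
      tensorD P (cone χ) a c rfl (coneTensorFst P χ a c n z) := by
  suffices H : coneTensorFst P χ a c (n + 1) ∘ₗ (-tensorD P K a c rfl) +
      coneTensorSnd P χ a c (n + 1) ∘ₗ BimoduleHom.app (tensorMap (𝟙 P) χ) a c (n + 1) =
      tensorD P (cone χ) a c rfl ∘ₗ coneTensorFst P χ a c n from LinearMap.congr_fun H z
  refine tensor_ext fun b p q h x y => ?_
  obtain ⟨q, rfl⟩ : ∃ q', q = q' + 1 := ⟨q - 1, by omega⟩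
  have e : (-1 : k) ^ (p + 1) = -(-1) ^ p := by rw [zpow_add₀ (by simp)]; simp
  have h₁ : p + 1 + q = n + 1 := by omega
  have h₂ : p + (q + 1) = n + 1 := by omega
  have hl : coneTensorFst P χ a c (n + 1) (-tensorD P K a c rfl (tmul P K a b c h x y)) =
      (-1 : k) ^ p • tmul P (cone χ) a b c h₁ (P.d rfl x) (y, 0) -
        tmul P (cone χ) a b c h₂ x (K.d rfl y, 0) := by
    rw [tensorD_tmul P K rfl h rfl rfl (by omega) (by omega), map_neg, map_add, map_smul,
      coneTensorFst_tmul P χ _ h₁, coneTensorFst_tmul P χ _ h₂, smul_smul, sign_mul_self,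
      one_smul, e, neg_smul]
    abel
  have hr : tensorD P (cone χ) a c rfl (coneTensorFst P χ a c n (tmul P K a b c h x y)) =
      (-1 : k) ^ p • tmul P (cone χ) a b c h₁ (P.d rfl x) (y, 0) +
        tmul P (cone χ) a b c h₂ x (-K.d rfl y, χ.app b c _ y + L.d rfl 0) := by
    rw [coneTensorFst_tmul P χ h (show p + q = n by omega), map_smul,
      tensorD_tmul P (cone χ) rfl _ rfl rfl h₁ h₂, smul_add, smul_smul, sign_mul_self, one_smul,
      cone_d_apply]
  have hn : ((-K.d rfl y, χ.app b c _ y + L.d rfl 0) : (cone χ).obj b c (q + 1)) =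
      -(K.d rfl y, 0) + (0, χ.app b c _ y) := by
    ext <;> simp
  rw [LinearMap.add_apply, LinearMap.comp_apply, LinearMap.comp_apply, LinearMap.comp_apply,
    LinearMap.neg_apply, tensorMap_app_tmul, coneTensorSnd_tmul, hl, hr, hn, map_add, map_neg,
    sub_eq_add_neg, add_assoc]
  rfl

theorem coneTensorSnd_d (a : Pt.{u}) (c : C) (n : ℤ) (z : TensorObj P L a c n) :
    coneTensorSnd P χ a c (n + 1) (tensorD P L a c rfl z) =
      tensorD P (cone χ) a c rfl (coneTensorSnd P χ a c n z) := by
  refine LinearMap.congr_fun (f := coneTensorSnd P χ a c (n + 1) ∘ₗ tensorD P L a c rfl)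
    (g := tensorD P (cone χ) a c rfl ∘ₗ coneTensorSnd P χ a c n)
    (tensor_ext fun b p q h x y => ?_) z
  rw [LinearMap.comp_apply, LinearMap.comp_apply,
    coneTensorSnd_tmul, tensorD_tmul P L rfl h rfl rfl (by omega) (by omega),
    tensorD_tmul P (cone χ) rfl h rfl rfl (by omega) (by omega), map_add, map_smul,
    coneTensorSnd_tmul, coneTensorSnd_tmul, cone_d_apply]
  simp

theorem coneTensorFst_ract (a : Pt.{u}) {c c' : C} {n s m : ℤ} (hs : n + s = m)
    (hs' : n + 1 + s = m + 1) (z : TensorObj P K a c (n + 1)) (f : DGCategory.Hom k c' c s) :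
    coneTensorFst P χ a c' m (tensorRact P K a hs' z f) =
      tensorRact P (cone χ) a hs (coneTensorFst P χ a c n z) f := by
  refine LinearMap.congr_fun (f := coneTensorFst P χ a c' m ∘ₗ (tensorRact P K a hs').flip f)
    (g := (tensorRact P (cone χ) a hs).flip f ∘ₗ coneTensorFst P χ a c n)
    (tensor_ext fun b p q h x y => ?_) z
  obtain ⟨q, rfl⟩ : ∃ q', q = q' + 1 := ⟨q - 1, by omega⟩
  rw [LinearMap.comp_apply, LinearMap.comp_apply, LinearMap.flip_apply, LinearMap.flip_apply,
    coneTensorFst_tmul P χ h (by omega),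
    tensorRact_tmul P K _ h (show q + 1 + s = q + s + 1 by omega) (by omega),
    coneTensorFst_tmul P χ _ (by omega), map_smul, LinearMap.smul_apply,
    tensorRact_tmul P (cone χ) hs _ rfl (by omega)]
  congr 2
  ext <;> simp

theorem coneTensorSnd_ract (a : Pt.{u}) {c c' : C} {n s m : ℤ} (hs : n + s = m)
    (z : TensorObj P L a c n) (f : DGCategory.Hom k c' c s) :
    coneTensorSnd P χ a c' m (tensorRact P L a hs z f) =
      tensorRact P (cone χ) a hs (coneTensorSnd P χ a c n z) f := by
  refine LinearMap.congr_fun (f := coneTensorSnd P χ a c' m ∘ₗ (tensorRact P L a hs).flip f)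
    (g := (tensorRact P (cone χ) a hs).flip f ∘ₗ coneTensorSnd P χ a c n)
    (tensor_ext fun b p q h x y => ?_) z
  rw [LinearMap.comp_apply, LinearMap.comp_apply, LinearMap.flip_apply, LinearMap.flip_apply,
    coneTensorSnd_tmul, tensorRact_tmul P L hs h rfl (by omega), coneTensorSnd_tmul,
    tensorRact_tmul P (cone χ) hs h rfl (by omega)]
  congr 1
  ext <;> simp

/-- `cone (P ⊗ χ) ⟶ P ⊗ cone χ`. -/
noncomputable def coneTensorHom : cone (tensorMap (𝟙 P) χ) ⟶ tensor P (cone χ) :=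
  homOfRight (M := cone (tensorMap (𝟙 P) χ)) (N := tensor P (cone χ))
    (fun a c n => LinearMap.coprod (coneTensorFst P χ a c n) (coneTensorSnd P χ a c n))
    (by
      rintro a c n m hnm ⟨z, w⟩
      subst hnm
      rw [cone_d_apply, LinearMap.coprod_apply, LinearMap.coprod_apply]
      dsimp only
      rw [map_add, map_add, ← coneTensorFst_d, ← coneTensorSnd_d]
      exact (add_assoc _ _ _).symm)
    (by
      rintro a c c' n s m hs ⟨z, w⟩ f
      rw [LinearMap.coprod_apply, LinearMap.coprod_apply, map_add, LinearMap.add_apply]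
      dsimp only
      rw [← coneTensorFst_ract P χ a hs (by omega), ← coneTensorSnd_ract]
      rfl)

/-- `P ⊗ cone χ` and `cone (P ⊗ χ)` are isomorphic. -/
noncomputable def tensorConeIso : tensor P (cone χ) ≅ cone (tensorMap (𝟙 P) χ) where
  hom := tensorConeHom P χ
  inv := coneTensorHom P χ
  hom_inv_id := BimoduleHom.ext (funext fun a => funext fun c => funext fun n =>
    tensor_ext fun b p q h x y => by
      change coneTensorFst P χ a c n (tensorConeApp P χ a c n _).1 +
        coneTensorSnd P χ a c n (tensorConeApp P χ a c n _).2 = tmul P (cone χ) a b c h x y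
      rw [tensorConeApp_tmul, map_smul, coneTensorFst_tmul P χ _ h, coneTensorSnd_tmul, smul_smul,
        sign_mul_self, one_smul, ← map_add]
      simp)
  inv_hom_id := BimoduleHom.ext (funext fun a => funext fun c => funext fun n =>
    LinearMap.prod_ext
      (tensor_ext fun b p q h x y => by
        obtain ⟨q, rfl⟩ : ∃ q', q = q' + 1 := ⟨q - 1, by omega⟩
        change tensorConeApp P χ a c n (coneTensorFst P χ a c n (tmul P K a b c h x y) +
          coneTensorSnd P χ a c n 0) =
          (tmul P K a b c h x y, 0)
        rw [map_zero, add_zero, coneTensorFst_tmul P χ h (by omega), map_smul, tensorConeApp_tmul]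
        ext
        · simp [smul_smul, sign_mul_self]
        · simp)
      (tensor_ext fun b p q h x y => by
        change tensorConeApp P χ a c n (coneTensorFst P χ a c n 0 +
          coneTensorSnd P χ a c n (tmul P L a b c h x y)) =   (0, tmul P L a b c h x y)
        rw [map_zero, zero_add, coneTensorSnd_tmul, tensorConeApp_tmul]
        ext
        · simp
        · simp))

end Cone
end

section

variable {k : Type u} [Field k] {B C D : Type u} [DGCategory k B] [DGCategory k C]
  [DGCategory k D]

/-! ## associativity of tensor products -/

section Assoc

variable (P : RightModule k B) (K : Bimodule k B C) (L : Bimodule k C D)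

variable {P K L} in
-- Triple pure tensors span, which reduces the identities for the associativity maps to generators.
theorem tensor_ext_right {a : Pt.{u}} {d : D} {n : ℤ} {X : Type u} [AddCommGroup X] [Module k X]
    {φ ψ : TensorObj P (tensor K L) a d n →ₗ[k] X}
    (H : ∀ (b : B) (c : C) (p q s t : ℤ) (h : p + q = n) (hst : s + t = q) (x : P.obj a b p)
      (y : K.obj b c s) (z : L.obj c d t),
      φ (tmul P (tensor K L) a b d h x (tmul K L b c d hst y z)) =
        ψ (tmul P (tensor K L) a b d h x (tmul K L b c d hst y z))) : φ = ψ :=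
  tensor_ext fun b p q h x w => LinearMap.congr_fun
    (f := φ ∘ₗ tmul P (tensor K L) a b d h x) (g := ψ ∘ₗ tmul P (tensor K L) a b d h x)
    (tensor_ext fun c s t hst y z => H b c p q s t h hst x y z) w

variable {P K L} in
theorem tensor_ext_left {a : Pt.{u}} {d : D} {n : ℤ} {X : Type u} [AddCommGroup X] [Module k X]
    {φ ψ : TensorObj (tensor P K) L a d n →ₗ[k] X}
    (H : ∀ (b : B) (c : C) (p q s t : ℤ) (h : q + t = n) (hps : p + s = q) (x : P.obj a b p)
      (y : K.obj b c s) (z : L.obj c d t),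
      φ (tmul (tensor P K) L a c d h (tmul P K a b c hps x y) z) =
        ψ (tmul (tensor P K) L a c d h (tmul P K a b c hps x y) z)) : φ = ψ :=
  tensor_ext fun c q t h w z => LinearMap.congr_fun
    (f := φ ∘ₗ (tmul (tensor P K) L a c d h).flip z)
    (g := ψ ∘ₗ (tmul (tensor P K) L a c d h).flip z)
    (tensor_ext fun b p s hps x y => H b c p q s t h hps x y z) w

/-- The map `y ⊗ z ↦ (x ⊗ y) ⊗ z`. -/
noncomputable def assocAux {a : Pt.{u}} {b : B} {d : D} {p q n : ℤ} (h : p + q = n)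
    (x : P.obj a b p) : TensorObj K L b d q →ₗ[k] TensorObj (tensor P K) L a d n :=
  tensorLift
    (fun c s t hst => (tmul (tensor P K) L a c d (show (p + s) + t = n by omega)).comp
      (tmul P K a b c rfl x))
    (by
      intro c c' s r t sr rt hsr hrt h₁ h₂ y f z
      subst hsr
      rw [LinearMap.comp_apply, LinearMap.comp_apply,
        ← tensorRact_tmul P K (show p + s + r = p + (s + r) by omega) rfl rfl rfl x y f]
      exact tmul_ract (F := tensor P K) (show p + s + r = p + (s + r) by omega) hrt _ _ _ f z)

/-- The degree of `x ⊗ y` is a variable `r` with `p + s = r`. The formula thus applies after a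
differential or an action has changed the degree to an expression that equals `p + s` only up to
rearrangement. -/
theorem assocAux_tmul {a : Pt.{u}} {b : B} {c : C} {d : D} {p q s t r n : ℤ} (h : p + q = n)
    (hst : s + t = q) (hps : p + s = r) (hr : r + t = n) (x : P.obj a b p) (y : K.obj b c s)
    (z : L.obj c d t) :
    assocAux P K L h x (tmul K L b c d hst y z) =
      tmul (tensor P K) L a c d hr (tmul P K a b c hps x y) z := by
  subst hps
  exact tensorLift_tmul _ _ c hst y z

/-- The component of `P ⊗ (K ⊗ L) ⟶ (P ⊗ K) ⊗ L`. -/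
noncomputable def assocApp (a : Pt.{u}) (d : D) (n : ℤ) :
    TensorObj P (tensor K L) a d n →ₗ[k] TensorObj (tensor P K) L a d n :=
  tensorLift
    (fun b p q h => LinearMap.mk₂ k (fun x w => assocAux P K L h x w)
      (fun x x' w => LinearMap.congr_fun (tensor_ext (ψ := _ + _) fun c s t hst y z => by
        rw [LinearMap.add_apply]
        simp only [assocAux_tmul P K L h hst rfl (by omega), map_add, LinearMap.add_apply]) w)
      (fun l x w => LinearMap.congr_fun (tensor_ext (ψ := l • _) fun c s t hst y z => by
        rw [LinearMap.smul_apply]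
        simp only [assocAux_tmul P K L h hst rfl (by omega), map_smul, LinearMap.smul_apply]) w)
      (fun x w w' => map_add _ _ _) (fun l x w => map_smul _ _ _))
    (by
      intro b b' p r q pr rq hpr hrq h h' x f w
      refine LinearMap.congr_fun (f := assocAux P K L h (P.ract hpr x f))
        (g := assocAux P K L h' x ∘ₗ tensorLact K L d hrq f)
        (tensor_ext fun c s t hst y z => ?_) w
      rw [LinearMap.comp_apply, tensorLact_tmul K L hrq hst rfl (by omega),
        assocAux_tmul P K L h hst rfl (by omega),
        assocAux_tmul (r := pr + s) P K L h' _ (by omega) (by omega),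
        tmul_ract hpr rfl rfl (by omega)])

theorem assocApp_tmul {a : Pt.{u}} {b : B} {c : C} {d : D} {p q s t r n : ℤ} (h : p + q = n)
    (hst : s + t = q) (hps : p + s = r) (hr : r + t = n) (x : P.obj a b p) (y : K.obj b c s)
    (z : L.obj c d t) :
    assocApp P K L a d n (tmul P (tensor K L) a b d h x (tmul K L b c d hst y z)) =
      tmul (tensor P K) L a c d hr (tmul P K a b c hps x y) z :=
  (tensorLift_tmul _ _ b h x _).trans (assocAux_tmul P K L h hst hps hr x y z)

/-- The map `x ⊗ y ↦ x ⊗ (y ⊗ z)`. -/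
noncomputable def assocInvAux {a : Pt.{u}} {c : C} {d : D} {r t n : ℤ} (h : r + t = n)
    (z : L.obj c d t) : TensorObj P K a c r →ₗ[k] TensorObj P (tensor K L) a d n :=
  tensorLift
    (fun b p s hps => (tmul P (tensor K L) a b d (show p + (s + t) = n by omega)).compl₂
      ((tmul K L b c d rfl).flip z))
    (by
      intro b b' p r s pr rs hpr hrs h₁ h₂ x f y
      subst hrs
      rw [LinearMap.compl₂_apply, LinearMap.compl₂_apply, LinearMap.flip_apply,
        LinearMap.flip_apply,
        ← tensorLact_tmul K L (show r + (s + t) = r + s + t by omega) rfl rfl rfl f y z]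
      exact tmul_ract (K := tensor K L) hpr (show r + (s + t) = r + s + t by omega) _ _ x f _)

theorem assocInvAux_tmul {a : Pt.{u}} {b : B} {c : C} {d : D} {p q s t r n : ℤ} (h : p + q = n)
    (hst : s + t = q) (hps : p + s = r) (hr : r + t = n) (x : P.obj a b p) (y : K.obj b c s)
    (z : L.obj c d t) :
    assocInvAux P K L hr z (tmul P K a b c hps x y) =
      tmul P (tensor K L) a b d h x (tmul K L b c d hst y z) := by
  subst hst
  exact tensorLift_tmul _ _ b hps x y

/-- The component of `(P ⊗ K) ⊗ L ⟶ P ⊗ (K ⊗ L)`. -/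
noncomputable def assocInvApp (a : Pt.{u}) (d : D) (n : ℤ) :
    TensorObj (tensor P K) L a d n →ₗ[k] TensorObj P (tensor K L) a d n :=
  tensorLift
    (fun c r t h => LinearMap.mk₂ k (fun w z => assocInvAux P K L h z w)
      (fun w w' z => map_add _ _ _) (fun l w z => map_smul _ _ _)
      (fun w z z' => LinearMap.congr_fun (tensor_ext (ψ := _ + _) fun b p s hps x y => by
        rw [LinearMap.add_apply]
        simp only [assocInvAux_tmul P K L (show p + (s + t) = n by omega) rfl hps h, map_add]) w)
      (fun l w z => LinearMap.congr_fun (tensor_ext (ψ := l • _) fun b p s hps x y => by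
        rw [LinearMap.smul_apply]
        simp only [assocInvAux_tmul P K L (show p + (s + t) = n by omega) rfl hps h,
          map_smul]) w))
    (by
      intro c c' r i t ri it hri hit h h' w f z
      refine LinearMap.congr_fun (f := assocInvAux P K L h z ∘ₗ (tensorRact P K a hri).flip f)
        (g := assocInvAux P K L h' (L.lact hit f z))
        (tensor_ext fun b p s hps x y => ?_) w
      rw [LinearMap.comp_apply, LinearMap.flip_apply, tensorRact_tmul P K hri hps rfl (by omega),
        assocInvAux_tmul P K L (show p + (s + it) = n by omega) rfl hps h',
        assocInvAux_tmul (q := s + it) P K L (by omega) (by omega) _ h,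
        tmul_ract rfl hit (by omega) rfl])

theorem assocInvApp_tmul {a : Pt.{u}} {b : B} {c : C} {d : D} {p q s t r n : ℤ} (h : p + q = n)
    (hst : s + t = q) (hps : p + s = r) (hr : r + t = n) (x : P.obj a b p) (y : K.obj b c s)
    (z : L.obj c d t) :
    assocInvApp P K L a d n (tmul (tensor P K) L a c d hr (tmul P K a b c hps x y) z) =
      tmul P (tensor K L) a b d h x (tmul K L b c d hst y z) :=
  (tensorLift_tmul _ _ c hr _ z).trans (assocInvAux_tmul P K L h hst hps hr x y z)

/-- `P ⊗ (K ⊗ L) ⟶ (P ⊗ K) ⊗ L`. -/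
noncomputable def assocHom : tensor P (tensor K L) ⟶ tensor (tensor P K) L :=
  homOfRight (assocApp P K L)
    (by
      intro a d n m hnm w
      refine LinearMap.congr_fun (f := assocApp P K L a d m ∘ₗ tensorD P (tensor K L) a d hnm)
        (g := tensorD (tensor P K) L a d hnm ∘ₗ assocApp P K L a d n)
        (tensor_ext_right fun b c p q s t h hst x y z => ?_) w
      have e : (-1 : k) ^ (p + s) = (-1) ^ p * (-1) ^ s := zpow_add₀ (by simp) _ _
      rw [LinearMap.comp_apply, LinearMap.comp_apply,
        tensorD_tmul P (tensor K L) hnm h rfl rfl (by omega) (by omega),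
        tensorD_tmul K L rfl hst rfl rfl (by omega) (by omega),
        assocApp_tmul P K L h hst rfl (by omega),
        tensorD_tmul (tensor P K) L hnm _ rfl rfl (by omega) (by omega),
        tensorD_tmul P K rfl rfl rfl rfl (by omega) (by omega)]
      simp only [map_add, map_smul, LinearMap.add_apply, LinearMap.smul_apply, smul_add]
      rw [assocApp_tmul (r := p + s + 1) P K L _ hst (by omega) (by omega),
        assocApp_tmul (r := p + s + 1) P K L _ _ (by omega) (by omega),
        assocApp_tmul (r := p + s) P K L _ _ rfl (by omega), e, mul_smul]
      exact (add_assoc _ _ _).symm)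
    (by
      intro a d d' n i m hi w f
      refine LinearMap.congr_fun
        (f := assocApp P K L a d' m ∘ₗ (tensorRact P (tensor K L) a hi).flip f)
        (g := (tensorRact (tensor P K) L a hi).flip f ∘ₗ assocApp P K L a d n)
        (tensor_ext_right fun b c p q s t h hst x y z => ?_) w
      rw [LinearMap.comp_apply, LinearMap.comp_apply, LinearMap.flip_apply, LinearMap.flip_apply,
        tensorRact_tmul P (tensor K L) hi h rfl (by omega),
        tensorRact_tmul K L rfl hst rfl (by omega),
        assocApp_tmul P K L h hst rfl (by omega),
        tensorRact_tmul (tensor P K) L hi _ rfl (by omega),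
        assocApp_tmul P K L _ _ rfl (by omega)])

/-- `(P ⊗ K) ⊗ L ⟶ P ⊗ (K ⊗ L)`. -/
noncomputable def assocInv : tensor (tensor P K) L ⟶ tensor P (tensor K L) :=
  homOfRight (assocInvApp P K L)
    (by
      intro a d n m hnm w
      refine LinearMap.congr_fun (f := assocInvApp P K L a d m ∘ₗ tensorD (tensor P K) L a d hnm)
        (g := tensorD P (tensor K L) a d hnm ∘ₗ assocInvApp P K L a d n)
        (tensor_ext_left fun b c p q s t h hps x y z => ?_) w
      subst hps
      have e : (-1 : k) ^ (p + s) = (-1) ^ p * (-1) ^ s := zpow_add₀ (by simp) _ _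
      rw [LinearMap.comp_apply, LinearMap.comp_apply,
        tensorD_tmul (tensor P K) L hnm h rfl rfl (by omega) (by omega),
        tensorD_tmul P K rfl rfl rfl rfl (by omega) (by omega),
        assocInvApp_tmul P K L (show p + (s + t) = n by omega) rfl rfl h,
        tensorD_tmul P (tensor K L) hnm _ rfl rfl (by omega) (by omega),
        tensorD_tmul K L rfl rfl rfl rfl (by omega) (by omega)]
      simp only [map_add, map_smul, LinearMap.add_apply, LinearMap.smul_apply, smul_add]
      rw [assocInvApp_tmul (q := s + t) P K L (by omega) rfl _ (by omega),
        assocInvApp_tmul (q := s + t + 1) P K L (by omega) (by omega) _ (by omega),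
        assocInvApp_tmul (q := s + t + 1) P K L (by omega) (by omega) _ (by omega), e, mul_smul]
      exact add_assoc _ _ _)
    (by
      intro a d d' n i m hi w f
      refine LinearMap.congr_fun
        (f := assocInvApp P K L a d' m ∘ₗ (tensorRact (tensor P K) L a hi).flip f)
        (g := (tensorRact P (tensor K L) a hi).flip f ∘ₗ assocInvApp P K L a d n)
        (tensor_ext_left fun b c p q s t h hps x y z => ?_) w
      rw [LinearMap.comp_apply, LinearMap.comp_apply, LinearMap.flip_apply, LinearMap.flip_apply,
        tensorRact_tmul (tensor P K) L hi h rfl (by omega),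
        assocInvApp_tmul P K L (show p + (s + t) = n by omega) rfl hps h,
        tensorRact_tmul P (tensor K L) hi _ rfl (by omega),
        tensorRact_tmul K L rfl rfl rfl (by omega),
        assocInvApp_tmul (q := s + t + i) P K L (by omega) (by omega) hps (by omega)])

/-- `P ⊗ (K ⊗ L)` is a retract of `(P ⊗ K) ⊗ L`. -/
noncomputable def assocRetract : Retract (tensor P (tensor K L)) (tensor (tensor P K) L) where
  i := assocHom P K L
  r := assocInv P K L
  retract := BimoduleHom.ext (funext fun a => funext fun d => funext fun n =>
    tensor_ext_right fun b c p q s t h hst x y z => by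
      change assocInvApp P K L a d n (assocApp P K L a d n _) = _
      rw [assocApp_tmul P K L h hst rfl (by omega), assocInvApp_tmul P K L h hst rfl]
      rfl)

variable {P K L}

/-- Together with naturality of `assocInv`, this turns the objectwise retracts into a retract of
arrows, the input `coneRetract` needs to produce a retract of cones. -/
theorem assocHom_naturality {K' : Bimodule k B C} {L' : Bimodule k C D} (φ : K ⟶ K')
    (ψ : L ⟶ L') :
    tensorMap (𝟙 P) (tensorMap φ ψ) ≫ assocHom P K' L' =
      assocHom P K L ≫ tensorMap (tensorMap (𝟙 P) φ) ψ :=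
  BimoduleHom.ext (funext fun a => funext fun d => funext fun n =>
    tensor_ext_right fun b c p q s t h hst x y z => by
      change assocApp P K' L' a d n (BimoduleHom.app (tensorMap (𝟙 P) (tensorMap φ ψ)) a d n _) =
        BimoduleHom.app (tensorMap (tensorMap (𝟙 P) φ) ψ) a d n (assocApp P K L a d n _)
      rw [assocApp_tmul P K L h hst rfl (by omega), tensorMap_app_tmul, tensorMap_app_tmul,
        tensorMap_app_tmul, tensorMap_app_tmul, assocApp_tmul P K' L' h hst rfl])

theorem assocInv_naturality {K' : Bimodule k B C} {L' : Bimodule k C D} (φ : K ⟶ K')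
    (ψ : L ⟶ L') :
    tensorMap (tensorMap (𝟙 P) φ) ψ ≫ assocInv P K' L' =
      assocInv P K L ≫ tensorMap (𝟙 P) (tensorMap φ ψ) :=
  BimoduleHom.ext (funext fun a => funext fun d => funext fun n =>
    tensor_ext_left fun b c p q s t h hps x y z => by
      change assocInvApp P K' L' a d n
          (BimoduleHom.app (tensorMap (tensorMap (𝟙 P) φ) ψ) a d n _) =
        BimoduleHom.app (tensorMap (𝟙 P) (tensorMap φ ψ)) a d n (assocInvApp P K L a d n _)
      have h' : p + (s + t) = n := by omega
      rw [assocInvApp_tmul P K L h' rfl hps h, tensorMap_app_tmul, tensorMap_app_tmul,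
        tensorMap_app_tmul, tensorMap_app_tmul, assocInvApp_tmul P K' L' h' rfl hps])

end Assoc

end

section

variable {k : Type u} [Field k] {C : Type u} [DGCategory k C]

/-! ## complexes over the field -/

/-- Complexes over the field `k`. -/
abbrev FieldComplex (k : Type u) [Field k] := Bimodule k Pt.{u} Pt.{u}

/-- Over a field both halves of the factorization of `f` through its image split: `g` is a
projection of `W` onto the image followed by a section of `V` onto it. This is where the base being
a field enters. -/
theorem exists_generalized_inverse {V W : Type u} [AddCommGroup V] [Module k V] [AddCommGroup W]
    [Module k W] (f : V →ₗ[k] W) : ∃ g : W →ₗ[k] V, ∀ x, f (g (f x)) = f x := by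
  obtain ⟨g, hg⟩ := f.rangeRestrict.exists_rightInverse_of_surjective f.range_rangeRestrict
  obtain ⟨π, hπ⟩ := (LinearMap.range f).subtype.exists_leftInverse_of_injective (by simp)
  refine ⟨g ∘ₗ π, fun x => ?_⟩
  have h₁ : π (f x) = f.rangeRestrict x := LinearMap.congr_fun hπ (f.rangeRestrict x)
  have h₂ := congrArg Subtype.val (LinearMap.congr_fun hg (f.rangeRestrict x))
  rw [LinearMap.comp_apply, h₁]
  exact h₂

/-- A complex over a field has a homotopy `s` with `d s d = d` and `s s = 0`. -/
theorem exists_splitting_homotopy (V : FieldComplex k) :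
    ∃ s : ∀ (a c : Pt.{u}) (p q : ℤ), p + 1 = q → (V.obj a c q →ₗ[k] V.obj a c p),
      (∀ a c p q (h : p + 1 = q) x, V.d h (s a c p q h (V.d h x)) = V.d h x) ∧
      ∀ a c p q r (h : p + 1 = q) (h' : q + 1 = r) x, s a c p q h (s a c q r h' x) = 0 := by
  choose s₀ hs₀ using fun (a c : Pt.{u}) (p q : ℤ) (h : p + 1 = q) =>
    exists_generalized_inverse (V.d (b := a) (c := c) h)
  -- Replacing `s₀` by `s₀ d s₀` keeps `d s d = d` and adds the second identity `s d s = s` of a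
  -- reflexive generalized inverse.
  let s₁ := fun (a c : Pt.{u}) (p q : ℤ) (h : p + 1 = q) =>
    s₀ a c p q h ∘ₗ V.d h ∘ₗ s₀ a c p q h
  have h₁ : ∀ a c p q h x, s₁ a c p q h (V.d h (s₁ a c p q h x)) = s₁ a c p q h x := by
    intro a c p q h x
    simp only [s₁, LinearMap.comp_apply, hs₀]
  have h₂ : ∀ a c p q h x, V.d h (s₁ a c p q h (V.d h x)) = V.d h x := by
    intro a c p q h x
    simp only [s₁, LinearMap.comp_apply, hs₀]
  -- The factor `1 - s₁ d` is the identity on boundaries, so `d s d = d` persists. It kills the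
  -- image of `s₁` because `s₁ d s₁ = s₁`, which gives `s s = 0`.
  refine ⟨fun a c p q h => s₁ a c p q h ∘ₗ (LinearMap.id - s₁ a c q (q + 1) rfl ∘ₗ V.d rfl),
    fun a c p q h x => ?_, fun a c p q r h h' x => ?_⟩
  · simp [V.d_d, h₂]
  · subst h'
    simp [h₁]

/-- The projection `1 - d s - s d` of a complex. -/
def splitProj (V : FieldComplex k)
    (s : ∀ (a c : Pt.{u}) (p q : ℤ), p + 1 = q → (V.obj a c q →ₗ[k] V.obj a c p))
    (a c : Pt.{u}) (p : ℤ) : V.obj a c p →ₗ[k] V.obj a c p :=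
  LinearMap.id - V.d (show p - 1 + 1 = p by omega) ∘ₗ s a c (p - 1) p (by omega) -
    s a c p (p + 1) rfl ∘ₗ V.d rfl

theorem splitProj_apply (V : FieldComplex k)
    (s : ∀ (a c : Pt.{u}) (p q : ℤ), p + 1 = q → (V.obj a c q →ₗ[k] V.obj a c p))
    (a c : Pt.{u}) {p q r : ℤ} (h : p + 1 = q) (h' : q + 1 = r) (x : V.obj a c q) :
    splitProj V s a c q x = x - V.d h (s a c p q h x) - s a c q r h' (V.d h' x) := by
  subst h'
  obtain rfl : p = q - 1 := by omega
  rfl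

theorem lact_unit_mem (V : FieldComplex k)
    (S : ∀ (a c : Pt.{u}) (p : ℤ), Submodule k (V.obj a c p)) {a a' c : Pt.{u}} {p q r : ℤ}
    (h : p + q = r) (f : DGCategory.Hom k a a' p) (x : S a c q) : V.lact h f x.1 ∈ S a' c r := by
  cases a; cases a'
  by_cases hp : p = 0
  · subst hp
    obtain rfl : q = r := by omega
    rw [lact_unit]
    exact Submodule.smul_mem _ _ x.2
  · have hf : f = 0 := Subtype.ext (f.2 hp)
    rw [hf, map_zero]
    exact Submodule.zero_mem _

theorem ract_unit_mem (V : FieldComplex k)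
    (S : ∀ (a c : Pt.{u}) (p : ℤ), Submodule k (V.obj a c p)) {a c c' : Pt.{u}} {p q r : ℤ}
    (h : p + q = r) (x : S a c p) (f : DGCategory.Hom k c' c q) : V.ract h x.1 f ∈ S a c' r := by
  cases c; cases c'
  by_cases hq : q = 0
  · subst hq
    obtain rfl : p = r := by omega
    rw [ract_unit]
    exact Submodule.smul_mem _ _ x.2
  · have hf : f = 0 := Subtype.ext (f.2 hq)
    rw [hf, map_zero]
    exact Submodule.zero_mem _

/-- A family of graded subspaces of a complex, as a complex with zero differential. -/
@[reducible]
def gradedSubspace (V : FieldComplex k)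
    (S : ∀ (a c : Pt.{u}) (p : ℤ), Submodule k (V.obj a c p)) : FieldComplex k where
  obj a c p := S a c p
  d _ := 0
  lact h := LinearMap.mk₂ k (fun f x => ⟨V.lact h f x.1, lact_unit_mem V S h f x⟩)
    (fun f f' x => Subtype.ext (by simp)) (fun t f x => Subtype.ext (by simp))
    (fun f x x' => Subtype.ext (by simp)) (fun t f x => Subtype.ext (by simp))
  ract h := LinearMap.mk₂ k (fun x f => ⟨V.ract h x.1 f, ract_unit_mem V S h x f⟩)
    (fun x x' f => Subtype.ext (by simp)) (fun t x f => Subtype.ext (by simp))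
    (fun x f f' => Subtype.ext (by simp)) (fun t x f => Subtype.ext (by simp))
  d_d _ _ _ := rfl
  d_lact {_ _ _ p _ _ _ _ _} h hp hq hr h₁ h₂ f x := Subtype.ext (by
    change 0 = V.lact h₁ 0 x.1 + (-1 : k) ^ p • V.lact h₂ f 0
    simp)
  d_ract {_ _ _ p _ _ _ _ _} h hp hq hr h₁ h₂ x f := Subtype.ext (by
    change 0 = V.ract h₁ 0 f + (-1 : k) ^ p • V.ract h₂ x.1 0
    simp)
  one_lact h x := Subtype.ext (V.one_lact h x.1)
  ract_one h x := Subtype.ext (V.ract_one h x.1)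
  comp_lact hpq hqr h₁ h₂ g f x := Subtype.ext (V.comp_lact hpq hqr h₁ h₂ g f x.1)
  ract_comp hpq hqr h₁ h₂ x g f := Subtype.ext (V.ract_comp hpq hqr h₁ h₂ x.1 g f)
  lact_ract hpq hqr h₁ h₂ g x f := Subtype.ext (V.lact_ract hpq hqr h₁ h₂ g x.1 f)

/-- A complex with zero differential. -/
def HasZeroDifferential (V : FieldComplex k) : Prop :=
  ∀ (a c : Pt.{u}) (p q : ℤ) (h : p + 1 = q) (x : V.obj a c p), V.d h x = 0

/-- A complex over a field is a deformation of a complex with zero differential. -/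
theorem exists_deformation_retract (V : FieldComplex k) :
    ∃ (H : FieldComplex k) (_ : HasZeroDifferential H) (i : H ⟶ V) (r : V ⟶ H) (_ : i ≫ r = 𝟙 H)
      (s : ∀ (a c : Pt.{u}) (p q : ℤ), p + 1 = q → (V.obj a c q →ₗ[k] V.obj a c p)),
      ∀ a c p q r' (h : p + 1 = q) (h' : q + 1 = r') (x : V.obj a c q),
        x - BimoduleHom.app i a c q (r.app a c q x) =
          V.d h (s a c p q h x) + s a c q r' h' (V.d h' x) := by
  obtain ⟨s, hs, hss⟩ := exists_splitting_homotopy V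
  -- Let `e = 1 - d s - s d`. Then `e d = 0` and `d e = 0` follow from `d s d = d` and `d d = 0`,
  -- while `e e = e` also needs `s s = 0`. The image of `e` is therefore a graded subspace of
  -- cocycles, a model of the cohomology.
  have he : ∀ a c p q (h : p + 1 = q) x, splitProj V s a c q (V.d h x) = 0 := by
    intro a c p q h x
    rw [splitProj_apply V s a c h rfl, V.d_d, hs, map_zero, sub_self, sub_zero]
  have hd : ∀ a c p q (h : p + 1 = q) x, V.d h (splitProj V s a c p x) = 0 := by
    intro a c p q h x
    rw [splitProj_apply V s a c (show p - 1 + 1 = p by omega) h, map_sub, map_sub, V.d_d, hs,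
      sub_zero, sub_self]
  have hi : ∀ a c p (x : V.obj a c p),
      splitProj V s a c p (splitProj V s a c p x) = splitProj V s a c p x := by
    intro a c p x
    have h' : splitProj V s a c p (s a c p (p + 1) rfl (V.d rfl x)) = 0 := by
      rw [splitProj_apply V s a c (show p - 1 + 1 = p by omega) rfl, hss, hs, map_zero, sub_zero,
        sub_self]
    conv_lhs => rw [splitProj_apply V s a c (show p - 1 + 1 = p by omega) rfl x]
    rw [map_sub, map_sub, he, h', sub_zero, sub_zero]
  refine ⟨gradedSubspace V fun a c p => LinearMap.range (splitProj V s a c p),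
    fun a c p q h x => rfl,
    homOfLinear (fun a c p => (LinearMap.range (splitProj V s a c p)).subtype) ?_,
    homOfLinear (fun a c p => (splitProj V s a c p).rangeRestrict) ?_, ?_, s, ?_⟩
  · rintro a c p q h ⟨_, x, rfl⟩
    exact (hd a c p q h x).symm
  · intro a c p q h x
    exact Subtype.ext (he a c p q h x)
  · refine hom_ext ?_
    rintro a c p ⟨_, x, rfl⟩
    exact Subtype.ext (hi a c p x)
  · intro a c p q r h h' x
    change x - splitProj V s a c q x = _
    rw [splitProj_apply V s a c h h']
    abel

/-! ## tensor products of complexes over the field with right modules -/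

/-- Over the unit category the balancing relation only moves scalars across the tensor sign, so
every bilinear family satisfies it and `tensorLift` imposes no condition. -/
theorem balanced_unit {V : FieldComplex k} {G : RightModule k C} {X : Type u} [AddCommGroup X]
    [Module k X] {a : Pt.{u}} {c : C} {n : ℤ}
    (β : ∀ (b : Pt.{u}) (p q : ℤ), p + q = n → (V.obj a b p →ₗ[k] G.obj b c q →ₗ[k] X))
    (b b' : Pt.{u}) (p r q pr rq : ℤ) (hpr : p + r = pr) (hrq : r + q = rq)
    (h : pr + q = n) (h' : p + rq = n) (x : V.obj a b p) (f : DGCategory.Hom k b' b r)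
    (y : G.obj b' c q) :
    β b' pr q h (V.ract hpr x f) y = β b p rq h' x (G.lact hrq f y) := by
  cases b; cases b'
  by_cases hr : r = 0
  · subst hr
    obtain rfl : p = pr := by omega
    obtain rfl : q = rq := by omega
    rw [ract_unit, lact_unit, map_smul, map_smul, LinearMap.smul_apply]
  · have hf : f = 0 := Subtype.ext (f.2 hr)
    rw [hf, map_zero, map_zero, map_zero, LinearMap.zero_apply, LinearMap.zero_apply, map_zero]

/-- The homotopy `s ⊗ G`. -/
noncomputable def tensorHomotopy {V : FieldComplex k} (G : RightModule k C)
    (s : ∀ (a c : Pt.{u}) (p q : ℤ), p + 1 = q → (V.obj a c q →ₗ[k] V.obj a c p))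
    (a : Pt.{u}) (c : C) {n m : ℤ} (h : n + 1 = m) :
    TensorObj V G a c m →ₗ[k] TensorObj V G a c n :=
  tensorLift (fun b p q hpq => (tmul V G a b c (show p - 1 + q = n by omega)).comp
    (s a b (p - 1) p (by omega))) (balanced_unit _)

theorem tensorHomotopy_tmul {V : FieldComplex k} (G : RightModule k C)
    (s : ∀ (a c : Pt.{u}) (p q : ℤ), p + 1 = q → (V.obj a c q →ₗ[k] V.obj a c p))
    {a b : Pt.{u}} {c : C} {n m p p' q : ℤ} (h : n + 1 = m) (hpq : p + q = m) (hp : p' + 1 = p)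
    (h' : p' + q = n) (x : V.obj a b p) (y : G.obj b c q) :
    tensorHomotopy G s a c h (tmul V G a b c hpq x y) =
      tmul V G a b c h' (s a b p' p hp x) y := by
  obtain rfl : p' = p - 1 := by omega
  exact tensorLift_tmul _ _ b hpq x y

/-- In `d (s x ⊗ y)` and `(s ⊗ 1) d (x ⊗ y)` the two terms `s x ⊗ d y` occur with opposite signs,
since `s` lowers the degree of `x` by one. What remains is the original homotopy identity tensored
with `y`. -/
theorem tensorHomotopy_spec {V H : FieldComplex k} (G : RightModule k C) (i : H ⟶ V) (r : V ⟶ H)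
    (s : ∀ (a c : Pt.{u}) (p q : ℤ), p + 1 = q → (V.obj a c q →ₗ[k] V.obj a c p))
    (hs : ∀ a c p q r' (h : p + 1 = q) (h' : q + 1 = r') (x : V.obj a c q),
        x - BimoduleHom.app i a c q (r.app a c q x) =
          V.d h (s a c p q h x) + s a c q r' h' (V.d h' x))
    (a : Pt.{u}) (c : C) {n m l : ℤ} (h : n + 1 = m) (h' : m + 1 = l) (z : TensorObj V G a c m) :
    z - BimoduleHom.app (tensorMap i (𝟙 G)) a c m
        (BimoduleHom.app (tensorMap r (𝟙 G)) a c m z) =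
      tensorD V G a c h (tensorHomotopy G s a c h z) +
        tensorHomotopy G s a c h' (tensorD V G a c h' z) := by
  suffices H : LinearMap.id - BimoduleHom.app (tensorMap i (𝟙 G)) a c m ∘ₗ
        BimoduleHom.app (tensorMap r (𝟙 G)) a c m =
      tensorD V G a c h ∘ₗ tensorHomotopy G s a c h +
        tensorHomotopy G s a c h' ∘ₗ tensorD V G a c h' from LinearMap.congr_fun H z
  refine tensor_ext fun b p q hpq x y => ?_
  have e : (-1 : k) ^ p = -(-1) ^ (p - 1) := by
    rw [zpow_sub₀ (by simp), zpow_one, div_neg, div_one, neg_neg]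
  have hp : p - 1 + 1 = p := by omega
  rw [LinearMap.sub_apply, LinearMap.add_apply, LinearMap.comp_apply, LinearMap.comp_apply,
    LinearMap.comp_apply, LinearMap.id_apply, tensorMap_app_tmul, tensorMap_app_tmul,
    tensorHomotopy_tmul G s h hpq hp (by omega),
    tensorD_tmul V G h _ hp rfl hpq (show p - 1 + (q + 1) = m by omega),
    tensorD_tmul V G h' hpq rfl rfl (by omega) (by omega), map_add, map_smul,
    tensorHomotopy_tmul G s h' _ rfl hpq,
    tensorHomotopy_tmul (p' := p - 1) G s h' _ hp (by omega), e]
  have hx := hs a b (p - 1) p (p + 1) hp rfl x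
  have hx' : x = BimoduleHom.app i a b p (BimoduleHom.app r a b p x) +
      (V.d hp (s a b (p - 1) p hp x) + s a b p (p + 1) rfl (V.d rfl x)) := by rw [← hx]; abel
  conv_lhs => enter [1]; rw [hx']
  simp only [map_add, LinearMap.add_apply, id_app, neg_smul]
  abel

/-- On cohomology `i` and `r` are mutually inverse. For this, `y - i (r y)` has to be a boundary
only when `y` is a cocycle. -/
theorem isQuasiIso_of_homotopy_inverse {M N : RightModule k C} (i : M ⟶ N) (r : N ⟶ M)
    (hir : ∀ a c p (x : M.obj a c p), r.app a c p (i.app a c p x) = x)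
    (hri : ∀ a c p q l (h : p + 1 = q) (h' : q + 1 = l) (y : N.obj a c q), N.d h' y = 0 →
      ∃ w : N.obj a c p, N.d h w = y - i.app a c q (r.app a c q y)) :
    IsQuasiIso i ∧ IsQuasiIso r := by
  refine ⟨fun a c p q l h h' => ⟨?_, ?_⟩, fun a c p q l h h' => ⟨?_, ?_⟩⟩
  · rintro x - ⟨w, hw⟩
    exact ⟨r.app a c p w, by rw [← r.app_d, hw, hir]⟩
  · intro y hy
    obtain ⟨w, hw⟩ := hri a c p q l h h' y hy
    exact ⟨r.app a c q y, by rw [← r.app_d, hy, map_zero], -w, by rw [map_neg, hw]; abel⟩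
  · rintro y hy ⟨w, hw⟩
    obtain ⟨v, hv⟩ := hri a c p q l h h' y hy
    exact ⟨v + i.app a c p w, by rw [map_add, hv, ← i.app_d, hw]; abel⟩
  · intro x hx
    exact ⟨i.app a c q x, by rw [← i.app_d, hx, map_zero], 0, by rw [hir]; simp⟩

/-- Over a field, every complex is homotopy equivalent to one with zero differential, compatibly
with tensor products. -/
theorem exists_zeroDifferential_quasiIso (V : FieldComplex k) :
    ∃ (H : FieldComplex k) (_ : HasZeroDifferential H) (i : H ⟶ V) (r : V ⟶ H),
      ∀ G : RightModule k C, IsQuasiIso (tensorMap i (𝟙 G)) ∧ IsQuasiIso (tensorMap r (𝟙 G)) := by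
  obtain ⟨H, hH, i, r, hir, s, hs⟩ := exists_deformation_retract V
  refine ⟨H, hH, i, r, fun G => isQuasiIso_of_homotopy_inverse _ _ (fun a c p x => ?_)
    fun a c p q l h h' y hy => ⟨tensorHomotopy G s a c h y, ?_⟩⟩
  · refine LinearMap.congr_fun (f := BimoduleHom.app (tensorMap r (𝟙 G)) a c p ∘ₗ
      BimoduleHom.app (tensorMap i (𝟙 G)) a c p) (g := LinearMap.id)
      (tensor_ext fun b p q h x y => ?_) x
    have := LinearMap.congr_fun (congrFun (congrFun (congrFun
      (congrArg BimoduleHom.app hir) a) b) p) x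
    rw [LinearMap.comp_apply, tensorMap_app_tmul, tensorMap_app_tmul]
    exact congrArg (fun t => tmul H G a b c h t y) this
  · rw [tensorHomotopy_spec G i r s hs a c h h']
    change tensorD V G a c h' y = 0 at hy
    rw [hy, map_zero, add_zero]

end

section

variable {k : Type u} [Field k] {B C : Type u} [DGCategory k B] [DGCategory k C]

/-! ## tensor products with complexes with zero differential -/

section ZeroDifferential

variable (L : FieldComplex k) (M : RightModule k C)

/-- The morphism `M[-p] ⟶ L ⊗ M` given by an element of `L` of degree `p`. -/
noncomputable def tmulHom (hL : HasZeroDifferential L) {p : ℤ} (v : L.obj Pt.pt Pt.pt p) :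
    shift M (-p) ⟶ tensor L M :=
  homOfRight (M := shift M (-p)) (N := tensor L M)
    (fun a c n => tmul L M a Pt.pt c (show p + (n + -p) = n by omega) v)
    (by
      intro a c n m h x
      -- As `d v = 0`, the differential of `v ⊗ x` is `(-1)^p v ⊗ d x`. The shift by `-p`
      -- contributes `(-1)^(-p)`, which is the same sign.
      rw [tensorD_tmul L M h _ rfl (show n + -p + 1 = m + -p by omega) (by omega) (by omega), hL,
        map_zero, LinearMap.zero_apply, zero_add, LinearMap.smul_apply, map_smul, zpow_neg,
        ← inv_zpow, inv_neg, inv_one])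
    (by
      intro a c c' n s m h x f
      rw [tensorRact_tmul L M h _ (show n + -p + s = m + -p by omega) (by omega)])

variable {ι : ℤ → Type u} (β : ∀ p, Module.Basis (ι p) k (L.obj Pt.pt Pt.pt p))

variable {L M} in
theorem tensor_ext_basis {a : Pt.{u}} {c : C} {n : ℤ} {X : Type u} [AddCommGroup X] [Module k X]
    {φ ψ : TensorObj L M a c n →ₗ[k] X}
    (H : ∀ (p q : ℤ) (h : p + q = n) (e : ι p) (y : M.obj Pt.pt c q),
      φ (tmul L M a Pt.pt c h (β p e) y) = ψ (tmul L M a Pt.pt c h (β p e) y)) : φ = ψ :=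
  tensor_ext fun b p q h x y => LinearMap.congr_fun
    (f := φ ∘ₗ (tmul L M a b c h).flip y) (g := ψ ∘ₗ (tmul L M a b c h).flip y)
    ((β p).ext fun e => H p q h e y) x

/-- The shifts of `M` indexed by a homogeneous basis. -/
abbrev shiftFamily (M : RightModule k C) (ι : ℤ → Type u) (e : Σ p, ι p) : RightModule k C :=
  shift M (-e.1)

open Classical in
/-- The coordinates on `L ⊗ M` with respect to a homogeneous basis of `L`. -/
noncomputable def basisCoordApp (a : Pt.{u}) (c : C) (n : ℤ) :
    TensorObj L M a c n →ₗ[k] (directSum (shiftFamily M ι)).obj a c n :=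
  tensorLift
    (fun b p q h => (β p).constr k fun e =>
      (DirectSum.lof k (Σ p, ι p) (fun e => (shiftFamily M ι e).obj a c n) ⟨p, e⟩) ∘ₗ
        BimoduleHom.appOf (𝟙 M) b c (show q = n + -p by omega))
    (balanced_unit _)

open Classical in
-- Taking `y` in degree exactly `n + -p`, its degree in the shifted summand, makes the transport by
-- `appOf` trivial.
theorem basisCoordApp_tmul {a : Pt.{u}} {c : C} {n p : ℤ} (h : p + (n + -p) = n) (e : ι p)
    (y : M.obj Pt.pt c (n + -p)) :
    basisCoordApp L M β a c n (tmul L M a Pt.pt c h (β p e) y) =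
      DirectSum.lof k (Σ p, ι p) (fun e => (shiftFamily M ι e).obj a c n) ⟨p, e⟩ y := by
  refine (tensorLift_tmul _ _ Pt.pt h (β p e) y).trans ?_
  exact LinearMap.congr_fun ((β p).constr_basis k _ e) y

open Classical in
/-- The coordinates on `L ⊗ M`, as a morphism of right modules. -/
noncomputable def basisCoord (hL : HasZeroDifferential L) :
    tensor L M ⟶ directSum (shiftFamily M ι) :=
  homOfRight (M := tensor L M) (N := directSum (shiftFamily M ι)) (basisCoordApp L M β)
    (by
      intro a c n m hnm z
      refine LinearMap.congr_fun (f := basisCoordApp L M β a c m ∘ₗ tensorD L M a c hnm)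
        (g := (directSum (shiftFamily M ι)).d hnm ∘ₗ basisCoordApp L M β a c n)
        (tensor_ext_basis β fun p q h e y => ?_) z
      obtain rfl : q = n + -p := by omega
      rw [LinearMap.comp_apply, LinearMap.comp_apply, tensorD_tmul L M hnm h rfl
        (show n + -p + 1 = m + -p by omega) (by omega) (by omega), hL, map_zero,
        LinearMap.zero_apply, zero_add, map_smul, basisCoordApp_tmul, basisCoordApp_tmul,
        DirectSum.lmap_lof, LinearMap.smul_apply, map_smul, zpow_neg, ← inv_zpow, inv_neg,
        inv_one])
    (by
      intro a c c' n s m hs z f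
      refine LinearMap.congr_fun
        (f := basisCoordApp L M β a c' m ∘ₗ (tensorRact L M a hs).flip f)
        (g := ((directSum (shiftFamily M ι)).ract hs).flip f ∘ₗ basisCoordApp L M β a c n)
        (tensor_ext_basis β fun p q h e y => ?_) z
      obtain rfl : q = n + -p := by omega
      rw [LinearMap.comp_apply, LinearMap.comp_apply, LinearMap.flip_apply, LinearMap.flip_apply,
        tensorRact_tmul L M hs h (show n + -p + s = m + -p by omega) (by omega),
        basisCoordApp_tmul, basisCoordApp_tmul, LinearMap.mk₂_apply, DirectSum.lmap_lof]
      rfl)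

open Classical in
/-- If `L` has zero differential, then `L ⊗ M` is a retract of a direct sum of shifts of `M`. -/
noncomputable def tensorRetract (hL : HasZeroDifferential L) :
    Retract (tensor L M) (directSum (shiftFamily M ι)) where
  i := basisCoord L M β hL
  r := directSumDesc (M := shiftFamily M ι) fun e => tmulHom L M hL (β e.1 e.2)
  retract := by
    refine BimoduleHom.ext (funext fun a => funext fun c => funext fun n => ?_)
    suffices H : BimoduleHom.app (directSumDesc (M := shiftFamily M ι)
        fun e => tmulHom L M hL (β e.1 e.2)) a c n ∘ₗ basisCoordApp L M β a c n =
      LinearMap.id from H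
    refine tensor_ext_basis β fun p q h e y => ?_
    obtain rfl : q = n + -p := by omega
    rw [LinearMap.comp_apply, basisCoordApp_tmul]
    exact directSumDesc_app_lof (M := shiftFamily M ι)
      (fun e => tmulHom L M hL (β e.1 e.2)) ⟨p, e⟩ a c n y

variable {L M} in
-- A homogeneous basis of `L` splits `L ⊗ M` into copies of `M`, one shift for each basis element.
-- The basis may be infinite, which is why `Ads` must allow infinite sums.
theorem Ads.tensor {G : RightModule k C} (hL : HasZeroDifferential L) (hM : Ads G M) :
    Ads G (tensor L M) :=
  .summand (tensorRetract L M (fun p => Module.Basis.ofVectorSpace k (L.obj Pt.pt Pt.pt p)) hL)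
    (.directSum _ fun e => hM.shift (-e.1))

end ZeroDifferential

/-! ## decomposition of cones -/

/-- The projection `cone φ ⟶ M[1]`. -/
def coneFst {M N : RightModule k C} (φ : M ⟶ N) : cone φ ⟶ shift M 1 :=
  homOfRight (M := cone φ) (N := shift M 1) (fun _ _ _ => LinearMap.fst k _ _)
    (fun _ _ => by simp) (fun _ _ _ => by simp)

/-- The inclusion `N ⟶ cone φ`. -/
def coneInr {M N : RightModule k C} (φ : M ⟶ N) : N ⟶ cone φ :=
  homOfRight (M := N) (N := cone φ) (fun _ _ _ => LinearMap.inr k _ _)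
    (fun _ _ => by simp) (fun _ _ _ => by simp)

/-- The morphism `M'[1] ⟶ cone φ` given by a morphism `α` with `φ α = 0`. -/
def coneLift {M N M' : RightModule k C} (φ : M ⟶ N) (α : M' ⟶ M) (w : α ≫ φ = zeroHom _ _) :
    shift M' 1 ⟶ cone φ :=
  homOfRight (M := shift M' 1) (N := cone φ)
    (fun a c n => LinearMap.inl k _ _ ∘ₗ α.app a c (n + 1))
    (by
      intro a c p q h x
      subst h
      have := LinearMap.congr_fun (congrFun (congrFun (congrFun
        (congrArg BimoduleHom.app w) a) c) (p + 1)) x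
      ext
      · simp [α.app_d]
      · simpa using this.symm)
    (by
      intro a c c' p q r h x f
      ext
      · simp [α.app_ract]
      · simp)

/-- The morphism `cone φ ⟶ N'` given by a morphism `β` with `β φ = 0`. -/
def coneDesc {M N N' : RightModule k C} (φ : M ⟶ N) (β : N ⟶ N') (w : φ ≫ β = zeroHom _ _) :
    cone φ ⟶ N' :=
  homOfRight (M := cone φ) (N := N')
    (fun a c n => β.app a c n ∘ₗ LinearMap.snd k _ _)
    (by
      intro a c p q h x
      subst h
      have := LinearMap.congr_fun (congrFun (congrFun (congrFun
        (congrArg BimoduleHom.app w) a) c) (p + 1)) x.1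
      have this : β.app a c (p + 1) (φ.app a c (p + 1) x.1) = 0 := this
      simp [β.app_d, this])
    (by
      intro a c c' p q r h x f
      simp [β.app_ract])

/-- With zero differentials, a generalized inverse chosen degree by degree is automatically a
morphism. Then `u = 1 - gθ` projects `H` onto `ker θ`, and `v = 1 - θg` is a projection of `H'` with
kernel `im θ`. They stand in for the kernel and cokernel summands. -/
theorem exists_generalized_inverse_hom {H H' : FieldComplex k} (hH : HasZeroDifferential H)
    (hH' : HasZeroDifferential H') (θ : H ⟶ H') :
    ∃ (g : H' ⟶ H) (u : H ⟶ H) (v : H' ⟶ H'),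
      (∀ a c p x, BimoduleHom.app u a c p x = x - g.app a c p (θ.app a c p x)) ∧
      (∀ a c p x, BimoduleHom.app v a c p x = x - θ.app a c p (g.app a c p x)) ∧
      u ≫ θ = zeroHom _ _ ∧ θ ≫ v = zeroHom _ _ := by
  choose g hg using fun (a c : Pt.{u}) (p : ℤ) => exists_generalized_inverse (θ.app a c p)
  refine ⟨homOfLinear g fun h x => by rw [hH, hH', map_zero],
    homOfLinear (fun a c p => LinearMap.id - g a c p ∘ₗ θ.app a c p)
      fun h x => by rw [hH, hH, map_zero],
    homOfLinear (fun a c p => LinearMap.id - θ.app a c p ∘ₗ g a c p)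
      fun h x => by rw [hH', hH', map_zero],
    fun _ _ _ _ => rfl, fun _ _ _ _ => rfl, hom_ext fun a c p x => ?_, hom_ext fun a c p x => ?_⟩
  · change θ.app a c p (x - g a c p (θ.app a c p x)) = 0
    rw [map_sub, hg, sub_self]
  · change θ.app a c p x - θ.app a c p (g a c p (θ.app a c p x)) = 0
    rw [hg, sub_self]

theorem tensorMap_zero_left {F F' : RightModule k B} {K K' : Bimodule k B C} (ψ : K ⟶ K') :
    tensorMap (zeroHom F F') ψ = zeroHom _ _ :=
  BimoduleHom.ext (funext fun a => funext fun c => funext fun n =>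
    tensor_ext fun b p q h x y => by
      rw [tensorMap_app_tmul, zeroHom_app, zeroHom_app, map_zero, LinearMap.zero_apply])

/-- The identities `u + gθ = 1` on `H` and `θg + v = 1` on `H'` write the identity of `cone (θ ⊗ φ)`
as a sum of three endomorphisms. They factor through `(H ⊗ G)[1]`, `cone (1_H ⊗ φ) ≅ H ⊗ cone φ` and
`H' ⊗ G'`, all of which lie in `Ads X`. -/
theorem ads_cone_tensorMap_of_zeroDifferential {X : RightModule k C} {H H' : FieldComplex k}
    (hH : HasZeroDifferential H) (hH' : HasZeroDifferential H') (θ : H ⟶ H')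
    {G G' : RightModule k C} (φ : G ⟶ G') (hG : Ads X G) (hG' : Ads X G')
    (hφ : Ads X (cone φ)) : Ads X (cone (tensorMap θ φ)) := by
  obtain ⟨g, u, v, hu, hv, huθ, hθv⟩ := exists_generalized_inverse_hom hH hH' θ
  have w₁ : tensorMap u (𝟙 G) ≫ tensorMap θ φ = zeroHom _ _ := by
    rw [tensorMap_comp, huθ, tensorMap_zero_left]
  have w₂ : tensorMap θ φ ≫ tensorMap v (𝟙 G') = zeroHom _ _ := by
    rw [tensorMap_comp, hθv, tensorMap_zero_left]
  have w₃ : tensorMap θ φ ≫ tensorMap g (𝟙 G') =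
      tensorMap (θ ≫ g) (𝟙 G) ≫ tensorMap (𝟙 H) φ := by
    rw [tensorMap_comp, tensorMap_comp, Category.comp_id, Category.comp_id, Category.id_comp]
  have w₄ : tensorMap (𝟙 H) φ ≫ tensorMap θ (𝟙 G') =
      tensorMap (𝟙 H) (𝟙 G) ≫ tensorMap θ φ := by
    rw [tensorMap_comp, tensorMap_comp, Category.comp_id, Category.id_comp, Category.id_comp]
  have hc : Ads X (cone (tensorMap (𝟙 H) φ)) :=
    Ads.summand (Retract.ofIso (tensorConeIso H φ).symm) (Ads.tensor hH hφ)
  -- Omitting the factors `⊗ 1`, the inclusion is `(x, y) ↦ (x, (gθ x, g y), v y)` and the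
  -- retraction is `(x, (x', y'), z) ↦ (u x + x', θ y' + z)`. The composite is `(u x + gθ x, θ g y +
  -- v y) = (x, y)`.
  refine Ads.summand ⟨prodLift (coneFst _) (prodLift (coneMap _ _ w₃) (coneDesc _ _ w₂)),
    prodDesc (coneLift _ _ w₁) (prodDesc (coneMap _ _ w₄) (coneInr _)), ?_⟩
    (((Ads.tensor hH hG).shift 1).prod (hc.prod (Ads.tensor hH' hG')))
  have h₁ : ∀ a c n (z : TensorObj H G a c n),
      BimoduleHom.app (tensorMap u (𝟙 G)) a c n z + BimoduleHom.app (tensorMap (𝟙 H) (𝟙 G)) a c n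
        (BimoduleHom.app (tensorMap (θ ≫ g) (𝟙 G)) a c n z) = z := by
    intro a c n z
    suffices H : BimoduleHom.app (tensorMap u (𝟙 G)) a c n +
      BimoduleHom.app (tensorMap (𝟙 H) (𝟙 G)) a c n ∘ₗ
        BimoduleHom.app (tensorMap (θ ≫ g) (𝟙 G)) a c n = LinearMap.id from LinearMap.congr_fun H z
    refine tensor_ext fun b p q h x y => ?_
    rw [LinearMap.add_apply, LinearMap.comp_apply, tensorMap_app_tmul, tensorMap_app_tmul,
      tensorMap_app_tmul, hu, map_sub, LinearMap.sub_apply]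
    exact sub_add_cancel _ _
  have h₂ : ∀ a c n (z : TensorObj H' G' a c n),
      BimoduleHom.app (tensorMap θ (𝟙 G')) a c n (BimoduleHom.app (tensorMap g (𝟙 G')) a c n z) +
        BimoduleHom.app (tensorMap v (𝟙 G')) a c n z = z := by
    intro a c n z
    suffices H : BimoduleHom.app (tensorMap θ (𝟙 G')) a c n ∘ₗ
        BimoduleHom.app (tensorMap g (𝟙 G')) a c n +
        BimoduleHom.app (tensorMap v (𝟙 G')) a c n = LinearMap.id from LinearMap.congr_fun H z
    refine tensor_ext fun b p q h x y => ?_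
    rw [LinearMap.add_apply, LinearMap.comp_apply, tensorMap_app_tmul, tensorMap_app_tmul,
      tensorMap_app_tmul, hv, map_sub, LinearMap.sub_apply]
    exact add_sub_cancel _ _
  refine hom_ext fun a c n x => ?_
  rw [comp_app, prodDesc_app, prodLift_app]
  dsimp only
  rw [prodDesc_app, prodLift_app]
  dsimp only
  refine Prod.ext ?_ ?_
  · refine Eq.trans ?_ (h₁ a c (n + 1) x.1)
    exact congrArg (_ + ·) (add_zero _)
  · refine Eq.trans ?_ (h₂ a c n x.2)
    exact zero_add _

/-! ### Reduction to zero differentials and conclusion -/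

/-- The source is replaced along `i : H ⟶ V` and the target along `r : V' ⟶ H'`, so that `i ≫ ψ ≫ r`
is defined and both squares commute strictly. The cones of `ψ ⊗ φ`, `(i ≫ ψ) ⊗ φ` and `(i ≫ ψ ≫ r) ⊗
φ` are then linked by quasi-isomorphisms. -/
theorem ads_cone_tensorMap {X : RightModule k C} {V V' : FieldComplex k} (ψ : V ⟶ V')
    {G G' : RightModule k C} (φ : G ⟶ G') (hG : Ads X G) (hG' : Ads X G')
    (hφ : Ads X (cone φ)) : Ads X (cone (tensorMap ψ φ)) := by
  obtain ⟨H, hH, i, _, hi⟩ := exists_zeroDifferential_quasiIso (C := C) V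
  obtain ⟨H', hH', _, r, hr⟩ := exists_zeroDifferential_quasiIso (C := C) V'
  have w₁ : tensorMap (i ≫ ψ) φ ≫ 𝟙 _ = tensorMap i (𝟙 G) ≫ tensorMap ψ φ := by
    rw [Category.comp_id, tensorMap_comp, Category.id_comp]
  have w₂ : tensorMap (i ≫ ψ) φ ≫ tensorMap r (𝟙 G') = 𝟙 _ ≫ tensorMap ((i ≫ ψ) ≫ r) φ := by
    rw [Category.id_comp, tensorMap_comp, Category.comp_id]
  have q₁ := coneMap_isQuasiIso w₁ (hi G).1 (isQuasiIso_id _)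
  have q₂ := coneMap_isQuasiIso w₂ (isQuasiIso_id _) (hr G').2
  exact .quasiIso (.of q₁) (.quasiIso (QuasiIsomorphic.of q₂).symm
    (ads_cone_tensorMap_of_zeroDifferential hH hH' _ φ hG hG' hφ))

/-- Moving `P` inside the cone and reassociating gives the cone of `(1 ⊗ φ₁) ⊗ φ₂`, where `1 ⊗ φ₁`
is a map of complexes over `k`. -/
theorem ads_tensor_cone_boxMap {X : RightModule k C} (P : RightModule k B)
    {G₁ G₁' : LeftModule k B} {G₂ G₂' : RightModule k C} (φ₁ : G₁ ⟶ G₁') (φ₂ : G₂ ⟶ G₂')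
    (hG : Ads X G₂) (hG' : Ads X G₂') (hφ : Ads X (cone φ₂)) :
    Ads X (tensor P (cone (boxMap φ₁ φ₂))) :=
  .summand (Retract.ofIso (tensorConeIso P _)) <|
    .summand (coneRetract (assocRetract P G₁ G₂) (assocRetract P G₁' G₂')
      (assocHom_naturality φ₁ φ₂) (assocInv_naturality φ₁ φ₂))
    (ads_cone_tensorMap (tensorMap (𝟙 P) φ₁) φ₂ hG hG' hφ)

theorem ads_of_isConvolution {G₁ G₁' : LeftModule k B} {G₂ G₂' : RightModule k C}
    (φ₁ : G₁ ⟶ G₁') (φ₂ : G₂ ⟶ G₂') {F : RightModule k B} {T : RightModule k C}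
    (h : IsConvolution (cone (boxMap φ₁ φ₂)) F T) :
    Ads (prod G₂ (prod (cone φ₂) G₂')) T := by
  obtain ⟨P, -, -, hT⟩ := h
  refine .quasiIso hT.symm (ads_tensor_cone_boxMap P φ₁ φ₂ ?_ ?_ ?_)
  · exact .summand (retractProdLeft _ _) .self
  · exact .summand (retractProdRight _ _) (.summand (retractProdRight _ _) .self)
  · exact .summand (retractProdLeft _ _) (.summand (retractProdRight _ _) .self)

end

end DG

theorem mainTheorem2 (k : Type u) [Field k] (C : Type u) [DG.DGCategory k C]
    (G₁ G₁' : DG.LeftModule k C) (G₂ G₂' : DG.RightModule k C)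
    (φ₁ : G₁ ⟶ G₁') (φ₂ : G₂ ⟶ G₂') :
    (DG.IsPerfect G₂ → DG.IsPerfect G₂' → DG.IsWeaklyProduct (DG.cone (DG.boxMap φ₁ φ₂))) ∧
      ∀ F T : DG.RightModule k C, DG.IsConvolution (DG.cone (DG.boxMap φ₁ φ₂)) F T →
        DG.Ads (DG.prod G₂ (DG.prod (DG.cone φ₂) G₂')) T :=
  -- The perfect witness is the module `G₂ ⊕ cone φ₂ ⊕ G₂'` of the second claim. It serves for all
  -- `F` at once.
  ⟨fun h h' => ⟨_, h.prod ((DG.IsPerfect.cone φ₂ h h').prod h'),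
    fun _ _ _ hT => DG.ads_of_isConvolution φ₁ φ₂ hT⟩,
    fun _ _ hT => DG.ads_of_isConvolution φ₁ φ₂ hT⟩
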